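/- Let $\mu,\nu\in\mathbb R$ and let $\tau$ be a formal parameter. Let $U=U_\tau(so_{\mu,\nu}(2,2))$ be the $\tau$-adically complete, separated $\mathbb R[[\tau]]$-algebra topologically generated by $H,P,K,D,C_1,C_2$ subject to $$[K,H]=\nu e^{-\tau H}P,\quad [K,P]=\mu\tfrac{e^{\tau H}-1}{\tau},\quad [H,P]=0,\quad [K,D]=0,\quad [D,H]=\tfrac{1-e^{-\tau H}}{\tau},$$ $$[D,C_1]=-C_1+\tau\nu D^2,\quad [H,C_1]=-2\nu D,\quad [D,P]=P,\quad [D,C_2]=-C_2,\quad [P,C_2]=2\mu D,$$ $$[K,C_1]=\nu C_2,\quad [K,C_2]=\mu C_1-\tau\mu\nu D^2,\quad [H,C_2]=e^{-\tau H}K+Ke^{-\tau H},$$ $$[P,C_1]=-2K-\tau\nu(DP+PD),\quad [C_1,C_2]=-\tau\nu(DC_2+C_2D).$$ Write $\hat\otimes$ for the $\tau$-adically completed tensor product over $\mathbb R[[\tau]]$ and $\sigma(X\otimes Y)=Y\otimes X$ for the flip. There is exactly one $\mathbb R[[\tau]]$-algebra homomorphism $\Delta:U\to U\hat\otimes U$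 with $$\Delta(H)=1\otimes H+H\otimes 1,\quad \Delta(D)=1\otimes D+D\otimes e^{-\tau H},\quad \Delta(P)=1\otimes P+P\otimes e^{\tau H},\quad \Delta(C_1)=1\otimes C_1+C_1\otimes e^{-\tau H},$$ $$\Delta(K)=1\otimes K+K\otimes 1-\tau\nu D\otimes e^{-\tau H}P,$$ $$\Delta(C_2)=1\otimes C_2+C_2\otimes e^{-\tau H}+2\tau D\otimes e^{-\tau H}K-\tau^2\nu(D^2+D)\otimes e^{-2\tau H}P,$$ and $\Delta$, together with a counit $\varepsilon:U\to\mathbb R[[\tau]]$ that vanishes on the six generators, makes $U$ a topological bialgebra (coassociative and counital). Moreover the element $$\mathcal R=\exp\{\tau H\otimes D\}\exp\{-\tau D\otimes H\}\in U\hat\otimes U$$ is invertible and is a triangular universal $R$-matrix for $U$, that is, $$\mathcal R\,\Delta(X)\,\mathcal R^{-1}=\sigma\circ\Delta(X)\ \ (X\in U),\quad (\Delta\otimes \mathrm{id})\mathcal R=\mathcal R_{13}\mathcal R_{23},\quad (\mathrm{id}\otimes\Delta)\mathcal R=\mathcal R_{13}\mathcal R_{12},\quad \sigma(\mathcal R)=\mathcal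 R^{-1};$$ in particular the first identity holds for the six generators. It solves the quantum Yang--Baxter equation $\mathcal R_{12}\mathcal R_{13}\mathcal R_{23}=\mathcal R_{23}\mathcal R_{13}\mathcal R_{12}$ in $U\hat\otimes U\hat\otimes U$. Finally, with $f=1\otimes C_1+C_1\otimes 1+2\tau\nu D\otimes D$, $$e^{-\tau D\otimes H}\Delta(C_1)e^{\tau D\otimes H}=f,\qquad e^{\tau H\otimes D}\,f\,e^{-\tau H\otimes D}=\sigma\circ\Delta(C_1),$$ and for $X\in\{P,K,C_2\}$, with $\Delta_0(X)=1\otimes X+X\otimes 1$, $$e^{-\tau D\otimes H}\Delta(X)e^{\tau D\otimes H}=\Delta_0(X),\qquad e^{\tau H\otimes D}\Delta_0(X)e^{-\tau H\otimes D}=\sigma\circ\Delta(X).$$ -/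

import Mathlib

open scoped TensorProduct

noncomputable section

namespace JordanianSO22

/-! ### `τ`-adic completions of algebras over `ℝ⟦τ⟧` -/

/-- The ring `ℝ⟦τ⟧` of formal power series in the deformation parameter. -/
abbrev Rtau : Type := PowerSeries ℝ

/-- The deformation parameter `τ`. -/
def tau : Rtau := PowerSeries.X

/-- A real number as a constant of `ℝ⟦τ⟧`. -/
def sc (r : ℝ) : Rtau := PowerSeries.C r

section Completion

variable (A : Type) [Ring A] [Algebra Rtau A]

/-- The two-sided ideal `τ ^ N A`. -/
def tauIdeal (N : ℕ) : Ideal A := Ideal.span {algebraMap Rtau A (tau ^ N)}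

instance tauIdeal_isTwoSided (N : ℕ) : (tauIdeal A N).IsTwoSided where
  mul_mem_of_left := by
    intro a b ha
    obtain ⟨c, rfl⟩ := Ideal.mem_span_singleton'.1 ha
    refine Ideal.mem_span_singleton'.2 ⟨c * b, ?_⟩
    rw [mul_assoc, mul_assoc, Algebra.commutes]

theorem tauIdeal_succ_le (N : ℕ) : tauIdeal A (N + 1) ≤ tauIdeal A N := by
  refine Ideal.span_le.2 ?_
  rintro x rfl
  refine Ideal.mem_span_singleton'.2 ⟨algebraMap Rtau A tau, ?_⟩
  rw [← map_mul, ← pow_succ']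

/-- The projection `A / τ ^ (N + 1) A → A / τ ^ N A`. -/
def transQ (N : ℕ) : (A ⧸ tauIdeal A (N + 1)) →ₐ[Rtau] (A ⧸ tauIdeal A N) :=
  Ideal.Quotient.factorₐ Rtau (tauIdeal_succ_le A N)

/-- The compatible sequences in `∏ N, A / τ ^ N A`. -/
def hatSubalgebra : Subalgebra Rtau (∀ N : ℕ, A ⧸ tauIdeal A N) where
  carrier := {x | ∀ N, transQ A N (x (N + 1)) = x N}
  mul_mem' := by
    intro x y hx hy N
    simp only [Pi.mul_apply, map_mul]
    rw [hx N, hy N]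
  add_mem' := by
    intro x y hx hy N
    simp only [Pi.add_apply, map_add]
    rw [hx N, hy N]
  algebraMap_mem' := by
    intro r N
    simp only [Pi.algebraMap_apply, AlgHom.commutes]

/-- The `τ`-adic completion `lim_N A / τ ^ N A` of a (not necessarily commutative)
`ℝ⟦τ⟧`-algebra `A`. -/
def Hat : Type := ↥(hatSubalgebra A)

instance : Ring (Hat A) := inferInstanceAs (Ring ↥(hatSubalgebra A))

instance : Algebra Rtau (Hat A) := inferInstanceAs (Algebra Rtau ↥(hatSubalgebra A))

variable {A}

/-- The canonical map from `A` to its completion. -/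
def toHat : A →ₐ[Rtau] Hat A :=
  (AlgHom.pi
    (fun N => Ideal.Quotient.mkₐ Rtau (tauIdeal A N))).codRestrict (hatSubalgebra A)
    (fun _ _ => rfl)

/-- The projection of the completion of `A` onto `A / τ ^ N A`. -/
def proj (N : ℕ) : Hat A →ₐ[Rtau] (A ⧸ tauIdeal A N) :=
  (Pi.evalAlgHom Rtau (fun N : ℕ => A ⧸ tauIdeal A N) N).comp (hatSubalgebra A).val

theorem transQ_proj (N : ℕ) (x : Hat A) : transQ A N (proj (N + 1) x) = proj N x := x.2 N

theorem tau_smul_quot (N : ℕ) (x : A ⧸ tauIdeal A N) : tau ^ N • x = 0 := by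
  obtain ⟨a, rfl⟩ := Ideal.Quotient.mkₐ_surjective Rtau (tauIdeal A N) x
  rw [← map_smul]
  refine Ideal.Quotient.eq_zero_iff_mem.2 ?_
  rw [Algebra.smul_def, Algebra.commutes]
  exact Ideal.mul_mem_left _ _ (Ideal.mem_span_singleton_self _)

variable {B : Type} [Ring B] [Algebra Rtau B]

/-- The map `A / τ ^ N A → B / τ ^ N B` induced by an algebra map from `A` to the
completion of `B`. -/
def extLevel (f : A →ₐ[Rtau] Hat B) (N : ℕ) :
    (A ⧸ tauIdeal A N) →ₐ[Rtau] (B ⧸ tauIdeal B N) :=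
  Ideal.Quotient.liftₐ (tauIdeal A N) ((proj N).comp f) (by
    intro a ha
    obtain ⟨c, rfl⟩ := Ideal.mem_span_singleton'.1 ha
    rw [map_mul, AlgHom.commutes, ← Algebra.commutes, ← Algebra.smul_def, tau_smul_quot])

/-- The extension of an algebra map from `A` to the completion of `B` by continuity. -/
def extHat (f : A →ₐ[Rtau] Hat B) : Hat A →ₐ[Rtau] Hat B :=
  (AlgHom.pi
    (fun N => (extLevel f N).comp (proj N))).codRestrict (hatSubalgebra B) (by
    intro x N
    change transQ B N (extLevel f (N + 1) (proj (N + 1) x)) = extLevel f N (proj N x)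
    rw [← transQ_proj N x]
    obtain ⟨a, ha⟩ := Ideal.Quotient.mkₐ_surjective Rtau (tauIdeal A (N + 1)) (proj (N + 1) x)
    rw [← ha]
    exact (f a).2 N)

theorem proj_extHat (f : A →ₐ[Rtau] Hat B) (N : ℕ) (x : Hat A) :
    proj N (extHat f x) = extLevel f N (proj N x) := rfl

theorem extHat_toHat (f : A →ₐ[Rtau] Hat B) (a : A) : extHat f (toHat a) = f a := rfl

/-- The `τ`-adically convergent sum `∑ n, c n * τ ^ n * x ^ n` in the completion of `A`. -/
def tauSeries (c : ℕ → ℝ) (x : Hat A) : Hat A :=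
  ⟨fun N => ∑ n ∈ Finset.range N, (sc (c n) * tau ^ n) • proj N x ^ n, by
    intro N
    simp only [map_sum, map_smul, map_pow, transQ_proj]
    rw [Finset.sum_range_succ, mul_smul, tau_smul_quot, smul_zero, add_zero]⟩

/-- `exp (τ x) = ∑ n, τ ^ n * x ^ n / n!`. -/
def expT (x : Hat A) : Hat A := tauSeries (fun n => 1 / (n.factorial : ℝ)) x

/-- `(exp (τ x) - 1) / τ = ∑ n, τ ^ n * x ^ (n + 1) / (n + 1)!`. -/
def expDivT (x : Hat A) : Hat A :=
  x * tauSeries (fun n => 1 / ((n + 1).factorial : ℝ)) x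

end Completion

/-! ### Completed tensor products, coproducts and `R`-matrices -/

section Tensor

variable (A : Type) [Ring A] [Algebra Rtau A]

/-- The completed tensor square of `A`. -/
abbrev Hat2 : Type := Hat (A ⊗[Rtau] A)

/-- The completed tensor cube of `A`. -/
abbrev Hat3 : Type := Hat (A ⊗[Rtau] A ⊗[Rtau] A)

variable {A} {B : Type} [Ring B] [Algebra Rtau B]

/-- The pure tensor `a ⊗ b` in the completed tensor square. -/
def tens (a b : A) : Hat2 A := toHat (a ⊗ₜ[Rtau] b)

/-- The algebra map `a ⊗ b ↦ f a * g b` on the completed tensor square, for algebra maps `f`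
and `g` with commuting ranges. -/
def pairMap (f g : A →ₐ[Rtau] Hat B) (h : ∀ x y, Commute (f x) (g y)) : Hat2 A →ₐ[Rtau] Hat B :=
  extHat (Algebra.TensorProduct.lift f g h)

theorem pairMap_commute (f g : A →ₐ[Rtau] Hat B) (h : ∀ x y, Commute (f x) (g y)) (c : Hat B)
    (hf : ∀ x, Commute (f x) c) (hg : ∀ x, Commute (g x) c) (z : Hat2 A) :
    Commute (pairMap f g h z) c := by
  have key : ∀ t : A ⊗[Rtau] A, Commute (Algebra.TensorProduct.lift f g h t) c := by
    intro t
    induction t with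
    | zero => rw [map_zero]; exact Commute.zero_left _
    | tmul a b => rw [Algebra.TensorProduct.lift_tmul]; exact (hf a).mul_left (hg b)
    | add s t hs ht => rw [map_add]; exact hs.add_left ht
  refine Subtype.ext (funext fun N => ?_)
  obtain ⟨t, ht⟩ := Ideal.Quotient.mkₐ_surjective Rtau (tauIdeal (A ⊗[Rtau] A) N) (proj N z)
  change proj N (pairMap f g h z) * proj N c = proj N c * proj N (pairMap f g h z)
  have h2 : proj N (pairMap f g h z) = proj N (Algebra.TensorProduct.lift f g h t) := by
    rw [pairMap, proj_extHat, ← ht]; rfl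
  rw [h2, ← map_mul, ← map_mul, (key t).eq]

/-- `a ↦ a ⊗ 1 ⊗ 1`. -/
def slot1 : A →ₐ[Rtau] Hat3 A :=
  toHat.comp (Algebra.TensorProduct.includeLeft.comp Algebra.TensorProduct.includeLeft)

/-- `a ↦ 1 ⊗ a ⊗ 1`. -/
def slot2 : A →ₐ[Rtau] Hat3 A :=
  toHat.comp (Algebra.TensorProduct.includeLeft.comp Algebra.TensorProduct.includeRight)

/-- `a ↦ 1 ⊗ 1 ⊗ a`. -/
def slot3 : A →ₐ[Rtau] Hat3 A := toHat.comp Algebra.TensorProduct.includeRight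

theorem commute12 (x y : A) : Commute (slot1 x) (slot2 y) := by
  refine Commute.map ?_ (toHat : A ⊗[Rtau] A ⊗[Rtau] A →ₐ[Rtau] Hat3 A)
  simp [Commute, SemiconjBy]

theorem commute13 (x y : A) : Commute (slot1 x) (slot3 y) := by
  refine Commute.map ?_ (toHat : A ⊗[Rtau] A ⊗[Rtau] A →ₐ[Rtau] Hat3 A)
  simp [Commute, SemiconjBy]

theorem commute23 (x y : A) : Commute (slot2 x) (slot3 y) := by
  refine Commute.map ?_ (toHat : A ⊗[Rtau] A ⊗[Rtau] A →ₐ[Rtau] Hat3 A)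
  simp [Commute, SemiconjBy]

/-- `a ⊗ b ↦ a ⊗ b ⊗ 1`. -/
def leg12 : Hat2 A →ₐ[Rtau] Hat3 A := pairMap slot1 slot2 commute12

/-- `a ⊗ b ↦ a ⊗ 1 ⊗ b`. -/
def leg13 : Hat2 A →ₐ[Rtau] Hat3 A := pairMap slot1 slot3 commute13

/-- `a ⊗ b ↦ 1 ⊗ a ⊗ b`. -/
def leg23 : Hat2 A →ₐ[Rtau] Hat3 A := pairMap slot2 slot3 commute23

/-- The flip `a ⊗ b ↦ b ⊗ a`. -/
def flipHat : Hat2 A →ₐ[Rtau] Hat2 A :=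
  extHat (toHat.comp (Algebra.TensorProduct.comm Rtau A A).toAlgHom)

/-- The completed map `Δ ⊗ id`. -/
def deltaId (Δ : A →ₐ[Rtau] Hat2 A) : Hat2 A →ₐ[Rtau] Hat3 A :=
  pairMap (leg12.comp Δ) slot3
    (fun x y => pairMap_commute _ _ _ _ (fun a => commute13 a y) (fun a => commute23 a y) (Δ x))

/-- The completed map `id ⊗ Δ`. -/
def idDelta (Δ : A →ₐ[Rtau] Hat2 A) : Hat2 A →ₐ[Rtau] Hat3 A :=
  pairMap slot1 (leg23.comp Δ)
    (fun x y => (pairMap_commute _ _ _ _ (fun a => (commute12 x a).symm)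
      (fun a => (commute13 x a).symm) (Δ y)).symm)

/-- The completed map `ε ⊗ id`, `a ⊗ b ↦ ε(a) b`. -/
def epsId (ε : A →ₐ[Rtau] Rtau) : Hat2 A →ₐ[Rtau] Hat A :=
  extHat (toHat.comp (Algebra.TensorProduct.lift ((Algebra.ofId Rtau A).comp ε) (AlgHom.id Rtau A)
    (fun x y => Algebra.commutes (ε x) y)))

/-- The completed map `id ⊗ ε`, `a ⊗ b ↦ ε(b) a`. -/
def idEps (ε : A →ₐ[Rtau] Rtau) : Hat2 A →ₐ[Rtau] Hat A :=
  extHat (toHat.comp (Algebra.TensorProduct.lift (AlgHom.id Rtau A) ((Algebra.ofId Rtau A).comp ε)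
    (fun x y => (Algebra.commutes (ε y) x).symm)))

/-- `Δ` and `ε` make `A` a topological bialgebra over `ℝ⟦τ⟧`. -/
structure IsBialgebra (Δ : A →ₐ[Rtau] Hat2 A) (ε : A →ₐ[Rtau] Rtau) : Prop where
  coassoc : ∀ x, idDelta Δ (Δ x) = deltaId Δ (Δ x)
  counit_left : ∀ x, epsId ε (Δ x) = toHat x
  counit_right : ∀ x, idEps ε (Δ x) = toHat x

/-- `R` is a triangular universal `R`-matrix for the coproduct `Δ`. -/
structure IsTriangularRMatrix (Δ : A →ₐ[Rtau] Hat2 A) (R : (Hat2 A)ˣ) : Prop where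
  conj_coproduct : ∀ x, R.val * Δ x * R⁻¹.val = flipHat (Δ x)
  delta_id : deltaId Δ R.val = leg13 R.val * leg23 R.val
  id_delta : idDelta Δ R.val = leg13 R.val * leg12 R.val
  triangular : flipHat R.val = R⁻¹.val

/-- The quantum Yang-Baxter equation. -/
def YangBaxter (R : Hat2 A) : Prop :=
  leg12 R * leg13 R * leg23 R = leg23 R * leg13 R * leg12 R

end Tensor

/-! ### The quantum algebras `U_τ(so_{μ,ν}(2,2))` -/

/-- The generators. -/
inductive Gen : Type
  | H | P | K | D | C₁ | C₂

/-- The completed free `ℝ⟦τ⟧`-algebra on the six generators. -/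
abbrev Free : Type := Hat (FreeAlgebra Rtau Gen)

/-- A generator in the completed free algebra. -/
def fr (g : Gen) : Free := toHat (FreeAlgebra.ι Rtau g)

/-- The deformed commutation rules, where `⁅x, y⁆ = x * y - y * x`, `expT (-fr .H) = exp (-τ H)`,
`expDivT (fr .H) = (exp (τ H) - 1) / τ` and `-expDivT (-fr .H) = (1 - exp (-τ H)) / τ`. -/
inductive Rel (μ ν : ℝ) : Free → Free → Prop
  | KH : Rel μ ν ⁅fr .K, fr .H⁆ (sc ν • (expT (-fr .H) * fr .P))
  | KP : Rel μ ν ⁅fr .K, fr .P⁆ (sc μ • expDivT (fr .H))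
  | HP : Rel μ ν ⁅fr .H, fr .P⁆ 0
  | KD : Rel μ ν ⁅fr .K, fr .D⁆ 0
  | DH : Rel μ ν ⁅fr .D, fr .H⁆ (-expDivT (-fr .H))
  | DC₁ : Rel μ ν ⁅fr .D, fr .C₁⁆ (-fr .C₁ + (tau * sc ν) • fr .D ^ 2)
  | HC₁ : Rel μ ν ⁅fr .H, fr .C₁⁆ (-(sc (2 * ν) • fr .D))
  | DP : Rel μ ν ⁅fr .D, fr .P⁆ (fr .P)
  | DC₂ : Rel μ ν ⁅fr .D, fr .C₂⁆ (-fr .C₂)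
  | PC₂ : Rel μ ν ⁅fr .P, fr .C₂⁆ (sc (2 * μ) • fr .D)
  | KC₁ : Rel μ ν ⁅fr .K, fr .C₁⁆ (sc ν • fr .C₂)
  | KC₂ : Rel μ ν ⁅fr .K, fr .C₂⁆ (sc μ • fr .C₁ - (tau * sc (μ * ν)) • fr .D ^ 2)
  | HC₂ : Rel μ ν ⁅fr .H, fr .C₂⁆ (expT (-fr .H) * fr .K + fr .K * expT (-fr .H))
  | PC₁ : Rel μ ν ⁅fr .P, fr .C₁⁆ (-(2 * fr .K) - (tau * sc ν) • (fr .D * fr .P + fr .P * fr .D))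
  | C₁C₂ : Rel μ ν ⁅fr .C₁, fr .C₂⁆ (-((tau * sc ν) • (fr .D * fr .C₂ + fr .C₂ * fr .D)))

/-- The quotient of the completed free algebra by the deformed commutation rules. -/
def UAlg (μ ν : ℝ) : Type := RingQuot (Rel μ ν)

instance (μ ν : ℝ) : Ring (UAlg μ ν) := inferInstanceAs (Ring (RingQuot (Rel μ ν)))

instance (μ ν : ℝ) : Algebra Rtau (UAlg μ ν) :=
  inferInstanceAs (Algebra Rtau (RingQuot (Rel μ ν)))

/-- The quotient map from the completed free algebra. -/
def quo (μ ν : ℝ) : Free →ₐ[Rtau] UAlg μ ν := RingQuot.mkAlgHom Rtau (Rel μ ν)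

/-- The quantum algebra `U_τ(so_{μ,ν}(2,2))`: the (Hausdorff) `τ`-adically complete
`ℝ⟦τ⟧`-algebra topologically generated by the six generators subject to the deformed
commutation rules. -/
abbrev U (μ ν : ℝ) : Type := Hat (UAlg μ ν)

/-- A generator of `U_τ(so_{μ,ν}(2,2))`. -/
def gen (μ ν : ℝ) (g : Gen) : U μ ν := toHat (quo μ ν (fr g))

/-- `Δ` takes the values prescribed by the deformed coproduct on the generators. -/
structure IsCoproduct (μ ν : ℝ) (Δ : U μ ν →ₐ[Rtau] Hat2 (U μ ν)) : Prop where
  map_H : Δ (gen μ ν Gen.H) = tens 1 (gen μ ν Gen.H) + tens (gen μ ν Gen.H) 1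
  map_D : Δ (gen μ ν Gen.D) =
    tens 1 (gen μ ν Gen.D) + tens (gen μ ν Gen.D) (expT (-gen μ ν Gen.H))
  map_P : Δ (gen μ ν Gen.P) =
    tens 1 (gen μ ν Gen.P) + tens (gen μ ν Gen.P) (expT (gen μ ν Gen.H))
  map_C₁ : Δ (gen μ ν Gen.C₁) =
    tens 1 (gen μ ν Gen.C₁) + tens (gen μ ν Gen.C₁) (expT (-gen μ ν Gen.H))
  map_K : Δ (gen μ ν Gen.K) =
    tens 1 (gen μ ν Gen.K) + tens (gen μ ν Gen.K) 1
      - (tau * sc ν) • tens (gen μ ν Gen.D) (expT (-gen μ ν Gen.H) * gen μ ν Gen.P)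
  map_C₂ : Δ (gen μ ν Gen.C₂) =
    tens 1 (gen μ ν Gen.C₂) + tens (gen μ ν Gen.C₂) (expT (-gen μ ν Gen.H))
      + (2 * tau) • tens (gen μ ν Gen.D) (expT (-gen μ ν Gen.H) * gen μ ν Gen.K)
      - (tau ^ 2 * sc ν) • tens (gen μ ν Gen.D ^ 2 + gen μ ν Gen.D)
          (expT (-(2 * gen μ ν Gen.H)) * gen μ ν Gen.P)

/-- `H ⊗ D`. -/
def HD (μ ν : ℝ) : Hat2 (U μ ν) := tens (gen μ ν Gen.H) (gen μ ν Gen.D)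

/-- `D ⊗ H`. -/
def DH (μ ν : ℝ) : Hat2 (U μ ν) := tens (gen μ ν Gen.D) (gen μ ν Gen.H)

/-- The element `exp (τ H ⊗ D) exp (-τ D ⊗ H)`. -/
def Rmat (μ ν : ℝ) : Hat2 (U μ ν) := expT (HD μ ν) * expT (-DH μ ν)

/-- The undeformed coproduct `1 ⊗ X + X ⊗ 1` of a generator. -/
def prim (μ ν : ℝ) (g : Gen) : Hat2 (U μ ν) := tens 1 (gen μ ν g) + tens (gen μ ν g) 1

/-- The element `f = 1 ⊗ C₁ + C₁ ⊗ 1 + 2 τ ν D ⊗ D`. -/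
def fElt (μ ν : ℝ) : Hat2 (U μ ν) :=
  prim μ ν Gen.C₁ + (tau * sc (2 * ν)) • tens (gen μ ν Gen.D) (gen μ ν Gen.D)

end JordanianSO22

end

open JordanianSO22

/-!
The quantum algebra is a twist of the `τ`-adic completion of an enveloping algebra. Put
`X = (exp (τ H) - 1) / τ` and `C₁' = C₁ - τ ν D ^ 2`. In terms of `X, P, K, D, C₁', C₂` the deformed
commutation rules are those of an undeformed Lie algebra, so the primitive coproduct `Δ₀` of these
elements is compatible with them. The coproduct `Δ` is `F Δ₀ F⁻¹` with `F = exp (τ D ⊗ H)`; on the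
generators this is a computation with weight vectors of `D` and with elements on which `ad H` is
nilpotent (`semiconj_expT_weight`, `expT_mul_of_lie`, and `twist_P` to `twist_C₂`).

Existence of `Δ` (`isRep_coproductGen`) follows: rules without `H` on the left-hand side hold for
the primitive elements and are carried over by conjugation, the others are checked directly.
Uniqueness, and every reduction of an identity of algebra maps to the generators, rests on the
automatic continuity of algebra maps between completions (`proj_map_congr`).

Since `Δ₀` is symmetric, `R = F₂₁ F⁻¹` conjugates `Δ` into the opposite coproduct. For the
generator `H`, which is not primitive before twisting, this is deduced from the primitive element
`X`, because `h ↦ (exp (τ h) - 1) / τ` is injective (`expDivT_injective`). The same injectivity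
and the addition law `expDivT_add` give the identity between conjugates of `H` that the
first hexagon identity (`hexagon`) amounts to. The second hexagon identity is a cyclic permutation
of the first, by triangularity, and the Yang–Baxter equation follows from the first hexagon and the
conjugation property.

The quantum algebra and its tensor powers are not shown to be `τ`-torsion-free. Division by `τ` takes
place only in the completion of a polynomial algebra, in the proof of `expDivT_add`; everywhere else
the calculus is built on `expDivT` instead.
-/

noncomputable section

namespace JordanianSO22

/-! ### Completed algebras and their continuous maps -/

section Complete

variable {A : Type} [Ring A] [Algebra Rtau A] {B : Type} [Ring B] [Algebra Rtau B]

theorem hat_ext {x y : Hat A} (h : ∀ N, proj N x = proj N y) : x = y :=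
  Subtype.ext (funext h)

theorem exists_proj_toHat (N : ℕ) (x : Hat A) : ∃ a : A, proj N x = proj N (toHat a) := by
  obtain ⟨a, ha⟩ := Ideal.Quotient.mkₐ_surjective Rtau (tauIdeal A N) (proj N x)
  exact ⟨a, ha.symm⟩

theorem mk_eq_zero_iff (N : ℕ) (a : A) : proj N (toHat a) = 0 ↔ ∃ c, a = tau ^ N • c := by
  refine Ideal.Quotient.eq_zero_iff_mem.trans (Ideal.mem_span_singleton'.trans ?_)
  refine exists_congr fun c => ?_
  rw [Algebra.smul_def, Algebra.commutes]
  exact eq_comm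

theorem mk_eq_iff (N : ℕ) (a b : A) :
    proj N (toHat a) = proj N (toHat b) ↔ ∃ c, a = b + tau ^ N • c := by
  rw [← sub_eq_zero, ← map_sub, ← map_sub, mk_eq_zero_iff]
  simp only [sub_eq_iff_eq_add']

theorem proj_eq_of_le {M N : ℕ} (h : M ≤ N) {x y : Hat A} (hxy : proj N x = proj N y) :
    proj M x = proj M y := by
  induction N, h using Nat.le_induction with
  | base => exact hxy
  | succ N _ ih => exact ih (by rw [← transQ_proj, hxy, transQ_proj])

/-- The kernel of the projection of the completion onto `A / τ ^ N A` is generated by `τ ^ N`: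
this is what makes the completion of `A` complete. -/
theorem eq_tau_smul_of_proj_eq_zero {N : ℕ} {x : Hat A} (hx : proj N x = 0) :
    ∃ y, x = tau ^ N • y := by
  choose a ha using fun k => exists_proj_toHat (A := A) k x
  have h0 : ∃ b, a N = tau ^ N • b := by
    rw [← mk_eq_zero_iff, ← ha, hx]
  obtain ⟨b, hb⟩ := h0
  have hs : ∀ k, ∃ c, a (k + 1) = a k + tau ^ k • c := fun k => by
    rw [← mk_eq_iff, ← ha, ← proj_eq_of_le (Nat.le_succ k) (ha (k + 1))]
  choose c hc using hs
  -- The limit of the partial sums of `b + c N + τ c (N + 1) + τ ^ 2 c (N + 2) + ⋯`.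
  let s : ℕ → A := fun M => b + ∑ j ∈ Finset.range M, tau ^ j • c (N + j)
  have hs : ∀ M, tau ^ N • s M = a (N + M) := by
    intro M
    induction M with
    | zero => simp [s, hb]
    | succ M ih =>
      rw [← add_assoc, hc, ← ih]
      simp only [s, Finset.sum_range_succ, smul_add, smul_smul, pow_add, add_assoc]
  refine ⟨⟨fun M => proj M (toHat (s M)), fun M => ?_⟩, hat_ext fun M => ?_⟩
  · rw [transQ_proj, mk_eq_iff]
    exact ⟨c (N + M), by simp [s, Finset.sum_range_succ, add_assoc]⟩
  · change proj M x = tau ^ N • proj M (toHat (s M))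
    rw [← map_smul, ← map_smul, hs, ← proj_eq_of_le (Nat.le_add_left M N) (ha (N + M))]

/-- Algebra maps between completed algebras are automatically continuous. -/
theorem proj_map_congr (f : Hat A →ₐ[Rtau] Hat B) {N : ℕ} {x y : Hat A}
    (h : proj N x = proj N y) : proj N (f x) = proj N (f y) := by
  rw [← sub_eq_zero, ← map_sub] at h
  obtain ⟨z, hz⟩ := eq_tau_smul_of_proj_eq_zero h
  rw [← sub_eq_zero, ← map_sub, ← map_sub, hz, map_smul, map_smul, tau_smul_quot]

theorem hat_hom_ext {f g : Hat A →ₐ[Rtau] Hat B} (h : ∀ a, f (toHat a) = g (toHat a)) :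
    f = g := by
  refine AlgHom.ext fun x => hat_ext fun N => ?_
  obtain ⟨a, ha⟩ := exists_proj_toHat N x
  rw [proj_map_congr f ha, proj_map_congr g ha, h]

theorem proj_succ_tau_smul {N : ℕ} {x y : Hat A} (h : proj N x = proj N y) :
    proj (N + 1) (tau • x) = proj (N + 1) (tau • y) := by
  rw [← sub_eq_zero, ← map_sub] at h
  obtain ⟨z, hz⟩ := eq_tau_smul_of_proj_eq_zero h
  rw [← sub_eq_zero, ← map_sub, ← smul_sub, hz, smul_smul, ← pow_succ', map_smul, tau_smul_quot]

theorem proj_zero_eq (x y : Hat A) : proj 0 x = proj 0 y := by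
  have h : ∀ z : A ⧸ tauIdeal A 0, z = 0 := fun z => by
    have := tau_smul_quot 0 z
    rwa [pow_zero, one_smul] at this
  rw [h (proj 0 x), h (proj 0 y)]

/-- The completion of a `τ`-torsion-free algebra is `τ`-torsion-free. -/
theorem tau_smul_injective_of_torsionFree (hA : ∀ a b : A, tau • a = tau • b → a = b)
    {x y : Hat A} (h : tau • x = tau • y) : x = y := by
  refine hat_ext fun N => ?_
  obtain ⟨a, ha⟩ := exists_proj_toHat (N + 1) x
  obtain ⟨b, hb⟩ := exists_proj_toHat (N + 1) y
  have h1 : proj (N + 1) (toHat (tau • a)) = proj (N + 1) (toHat (tau • b)) := by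
    rw [map_smul, map_smul, map_smul, map_smul, ← ha, ← hb, ← map_smul, h, map_smul]
  obtain ⟨c, hc⟩ := (mk_eq_iff _ _ _).1 h1
  have h2 : a = b + tau ^ N • c := hA _ _ (by rw [hc, smul_add, smul_smul, pow_succ'])
  rw [proj_eq_of_le (Nat.le_succ N) ha, proj_eq_of_le (Nat.le_succ N) hb]
  exact (mk_eq_iff _ _ _).2 ⟨c, h2⟩

/-! ### Exponentials in completed algebras -/

theorem proj_tauSeries (c : ℕ → ℝ) (x : Hat A) (N : ℕ) :
    proj N (tauSeries c x) = ∑ n ∈ Finset.range N, (sc (c n) * tau ^ n) • proj N x ^ n := rfl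

theorem tau_term_eq_zero (r : ℝ) {N n : ℕ} (h : N ≤ n) (z : A ⧸ tauIdeal A N) :
    (sc r * tau ^ n) • z = 0 := by
  obtain ⟨k, rfl⟩ := Nat.exists_eq_add_of_le h
  rw [pow_add, mul_left_comm, mul_smul, tau_smul_quot]

/-- Further terms may be added to the finite sum that computes a `τ`-series modulo `τ ^ N`. -/
theorem proj_tauSeries_of_le (c : ℕ → ℝ) (x : Hat A) {N M : ℕ} (h : N ≤ M) :
    proj N (tauSeries c x) = ∑ n ∈ Finset.range M, (sc (c n) * tau ^ n) • proj N x ^ n := by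
  rw [proj_tauSeries]
  refine Finset.sum_subset (Finset.range_mono h) fun n _ hn => ?_
  exact tau_term_eq_zero _ (by simpa using hn) _

theorem proj_tauSeries_congr (c : ℕ → ℝ) {N : ℕ} {x y : Hat A} (h : proj N x = proj N y) :
    proj N (tauSeries c x) = proj N (tauSeries c y) := by
  rw [proj_tauSeries, proj_tauSeries, h]

/-- By continuity, algebra maps may be applied term by term. -/
theorem map_tauSeries (f : Hat A →ₐ[Rtau] Hat B) (c : ℕ → ℝ) (x : Hat A) :
    f (tauSeries c x) = tauSeries c (f x) := by
  refine hat_ext fun N => ?_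
  have h : proj N (tauSeries c x) =
      proj N (∑ n ∈ Finset.range N, (sc (c n) * tau ^ n) • x ^ n) := by
    simp only [map_sum, map_smul, map_pow, proj_tauSeries]
  rw [proj_map_congr f h]
  simp only [map_sum, map_smul, map_pow, proj_tauSeries]

theorem map_expT (f : Hat A →ₐ[Rtau] Hat B) (x : Hat A) : f (expT x) = expT (f x) :=
  map_tauSeries f _ x

theorem map_expDivT (f : Hat A →ₐ[Rtau] Hat B) (x : Hat A) :
    f (expDivT x) = expDivT (f x) := by
  rw [expDivT, map_mul, map_tauSeries]; rfl

theorem semiconj_tauSeries (c : ℕ → ℝ) {y x x' : Hat A} (h : SemiconjBy y x x') :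
    SemiconjBy y (tauSeries c x) (tauSeries c x') := by
  refine hat_ext fun N => ?_
  have h1 : SemiconjBy (proj N y) (proj N x) (proj N x') := by
    rw [SemiconjBy, ← map_mul, h.eq, map_mul]
  simp only [map_mul, proj_tauSeries, Finset.mul_sum, Finset.sum_mul]
  refine Finset.sum_congr rfl fun n _ => ?_
  rw [mul_smul_comm, smul_mul_assoc, (h1.pow_right n).eq]

theorem semiconjBy_expT {y x x' : Hat A} (h : SemiconjBy y x x') :
    SemiconjBy y (expT x) (expT x') := semiconj_tauSeries _ h

theorem semiconjBy_expDivT {y x x' : Hat A} (h : SemiconjBy y x x') :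
    SemiconjBy y (expDivT x) (expDivT x') := h.mul_right (semiconj_tauSeries _ h)

theorem commute_expT {y x : Hat A} (h : Commute y x) : Commute y (expT x) :=
  semiconjBy_expT h

theorem commute_expDivT {y x : Hat A} (h : Commute y x) : Commute y (expDivT x) :=
  semiconjBy_expDivT h

theorem sc_one : sc 1 = 1 := map_one _

theorem sc_mul (a b : ℝ) : sc (a * b) = sc a * sc b := map_mul _ _ _

theorem sc_natCast (n : ℕ) : sc n = n := map_natCast _ n

@[simp] theorem expDivT_zero : expDivT (0 : Hat A) = 0 := zero_mul _

theorem proj_expDivT (x : Hat A) (N : ℕ) : proj N (expDivT x) =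
    ∑ n ∈ Finset.range N, (sc (1 / ((n + 1).factorial : ℝ)) * tau ^ n) • proj N x ^ (n + 1) := by
  simp only [expDivT, map_mul, proj_tauSeries, Finset.mul_sum, mul_smul_comm, pow_succ']

theorem expT_eq (x : Hat A) : expT x = 1 + tau • expDivT x := by
  refine hat_ext fun N => ?_
  rw [expT, proj_tauSeries_of_le _ _ (Nat.le_succ N), Finset.sum_range_succ', map_add, map_smul,
    proj_expDivT, Finset.smul_sum, add_comm]
  congr 1
  · simp [sc_one]
  · refine Finset.sum_congr rfl fun n _ => ?_
    rw [smul_smul, pow_succ', mul_left_comm]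

@[simp] theorem expT_zero : expT (0 : Hat A) = 1 := by simp [expT_eq]

theorem expT_add {x y : Hat A} (h : Commute x y) : expT (x + y) = expT x * expT y := by
  refine hat_ext fun N => ?_
  let _ : Module ℚ (A ⧸ tauIdeal A N) := Module.compHom _ (algebraMap ℚ Rtau)
  have hq : ∀ (n : ℕ) (z : A ⧸ tauIdeal A N),
      ((n.factorial : ℚ)⁻¹) • z = sc (1 / (n.factorial : ℝ)) • z := by
    intro n z
    change (algebraMap ℚ Rtau (n.factorial : ℚ)⁻¹) • z = _
    congr 1
    rw [IsScalarTower.algebraMap_apply ℚ ℝ Rtau]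
    simp [sc]
  have hpow : ∀ z : A ⧸ tauIdeal A N, (tau • z) ^ N = 0 := fun z => by
    rw [smul_pow, tau_smul_quot]
  have hexp : ∀ z : Hat A, proj N (expT z) = IsNilpotent.exp (tau • proj N z) := by
    intro z
    rw [IsNilpotent.exp_eq_sum (hpow _), expT, proj_tauSeries]
    refine Finset.sum_congr rfl fun n _ => ?_
    rw [hq, smul_pow, smul_smul]
  have hc : Commute (tau • proj N x) (tau • proj N y) :=
    ((h.map (proj N)).smul_left tau).smul_right tau
  rw [map_mul, hexp, hexp, hexp, map_add, smul_add,
    IsNilpotent.exp_add_of_commute hc ⟨N, hpow _⟩ ⟨N, hpow _⟩]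

theorem expT_mul_expT_neg (x : Hat A) : expT x * expT (-x) = 1 := by
  rw [← expT_add (Commute.refl x).neg_right, add_neg_cancel, expT_zero]

theorem expT_neg_mul_expT (x : Hat A) : expT (-x) * expT x = 1 := by
  rw [← expT_add (Commute.refl x).neg_left, neg_add_cancel, expT_zero]

/-- The addition law of `(exp (τ x) - 1) / τ`. The two sides agree after multiplication by `τ`;
since `τ` may be a zero divisor, the law is first proved in the completion of the torsion-free
algebra `ℝ⟦τ⟧[X] ⊗ ℝ⟦τ⟧[X]` and then specialised. -/
theorem expDivT_add {x y : Hat A} (h : Commute x y) :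
    expDivT (x + y) = expDivT x + expT x * expDivT y := by
  have hT : ∀ a b : Polynomial Rtau ⊗[Rtau] Polynomial Rtau, tau • a = tau • b → a = b := fun a b hab =>
    smul_right_injective _ (PowerSeries.X_ne_zero : (PowerSeries.X : Rtau) ≠ 0) hab
  have hcomm : ∀ p q : Polynomial Rtau, Commute (Polynomial.aeval x p) (Polynomial.aeval y q) := by
    intro p q
    rw [Polynomial.aeval_eq_sum_range, Polynomial.aeval_eq_sum_range]
    exact Commute.sum_left _ _ _ fun i _ => Commute.sum_right _ _ _ fun j _ =>
      ((h.pow_pow i j).smul_left _).smul_right _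
  let Ψ : Hat (Polynomial Rtau ⊗[Rtau] Polynomial Rtau) →ₐ[Rtau] Hat A :=
    extHat (Algebra.TensorProduct.lift (Polynomial.aeval x) (Polynomial.aeval y) hcomm)
  let X : Hat (Polynomial Rtau ⊗[Rtau] Polynomial Rtau) := toHat (Polynomial.X ⊗ₜ 1)
  let Y : Hat (Polynomial Rtau ⊗[Rtau] Polynomial Rtau) := toHat (1 ⊗ₜ Polynomial.X)
  have hX : Ψ X = x := by simp [Ψ, X, extHat_toHat]
  have hY : Ψ Y = y := by simp [Ψ, Y, extHat_toHat]
  have hXY : Commute X Y := by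
    refine Commute.map ?_ (toHat (A := Polynomial Rtau ⊗[Rtau] Polynomial Rtau))
    simp [Commute, SemiconjBy]
  have key : expDivT (X + Y) = expDivT X + expT X * expDivT Y := by
    refine tau_smul_injective_of_torsionFree hT ?_
    have h1 := expT_eq (X + Y)
    rw [expT_add hXY, expT_eq X, expT_eq Y] at h1
    rw [expT_eq X]
    simp only [add_mul, mul_add, one_mul, mul_one, smul_mul_assoc, mul_smul_comm, smul_add] at h1 ⊢
    rw [← add_right_inj 1, ← h1]
    abel
  have := congrArg Ψ key
  simpa only [map_add, map_mul, map_expDivT, map_expT, hX, hY] using this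

theorem expDivT_neg (x : Hat A) : expDivT (-x) * expT x = -expDivT x := by
  have h := expDivT_add (Commute.refl x).neg_right
  rw [add_neg_cancel, expDivT_zero] at h
  have h1 : Commute (expDivT (-x)) (expT x) :=
    (commute_expDivT (commute_expT (Commute.refl x)).symm.neg_right).symm
  rw [h1.eq, eq_neg_iff_add_eq_zero, add_comm, ← h]

/-- `(exp (τ x) - 1) / τ = x + τ (x ^ 2 / 2 + ⋯)` determines `x`: if two elements agree
modulo `τ ^ N` and have the same image, they agree modulo `τ ^ (N + 1)`. -/
theorem expDivT_injective : Function.Injective (expDivT : Hat A → Hat A) := by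
  -- The linear term is separated from the rest, which is divisible by `τ`.
  have hsplit : ∀ z : Hat A, expDivT z = z + tau • (z * (z *
      tauSeries (fun n => 1 / ((n + 2).factorial : ℝ)) z)) := by
    intro z
    refine hat_ext fun N => ?_
    simp only [map_add, map_smul, map_mul, proj_tauSeries]
    rw [proj_expDivT, ← add_zero (Finset.sum _ _),
      ← tau_term_eq_zero (1 / ((N + 1).factorial : ℝ)) (le_refl N) (proj N z ^ (N + 1)),
      ← Finset.sum_range_succ, Finset.sum_range_succ', add_comm]
    congr 1
    · simp [sc_one]
    · simp only [Finset.mul_sum, Finset.smul_sum]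
      refine Finset.sum_congr rfl fun n _ => ?_
      rw [mul_smul_comm, mul_smul_comm, smul_smul, pow_succ' tau, mul_left_comm, ← mul_assoc,
        pow_succ', pow_succ']
  intro x y hxy
  refine hat_ext fun N => ?_
  induction N with
  | zero => exact proj_zero_eq x y
  | succ N ih =>
    have h1 := hsplit x
    rw [hxy, hsplit y] at h1
    have h2 := congrArg (proj (N + 1)) h1
    rw [map_add, map_add, proj_succ_tau_smul (x := y * _) (y := x * _) ?_] at h2
    · exact (add_right_cancel h2).symm
    · rw [map_mul, map_mul, map_mul, map_mul, ih, proj_tauSeries_congr _ ih]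

/-- If `[z, x]` commutes with `x`, the derivation `[z, -]` acts on `(exp (τ x) - 1) / τ` by the
chain rule. -/
theorem lie_expDivT {z x w : Hat A} (h : ⁅z, x⁆ = w) (hw : Commute w x) :
    ⁅z, expDivT x⁆ = w * expT x := by
  refine hat_ext fun N => ?_
  have hp : ∀ n : ℕ, z * x ^ (n + 1) = x ^ (n + 1) * z + ((n + 1 : ℕ) : Rtau) • (w * x ^ n) := by
    rw [Ring.lie_def, sub_eq_iff_eq_add] at h
    intro n
    induction n with
    | zero => simp [h, add_comm]
    | succ n ih =>
      rw [pow_succ x (n + 1), ← mul_assoc, ih, add_mul, mul_assoc, h, mul_add, ← mul_assoc,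
        smul_mul_assoc, mul_assoc w, ← pow_succ, ← (hw.pow_right (n + 1)).eq,
        Nat.cast_succ (n + 1), add_smul, one_smul, pow_succ x n]
      abel
  rw [Ring.lie_def, map_sub, map_mul, map_mul, map_mul, proj_expDivT, expT, proj_tauSeries,
    Finset.mul_sum, Finset.sum_mul, Finset.mul_sum, ← Finset.sum_sub_distrib]
  refine Finset.sum_congr rfl fun n _ => ?_
  have h1 := congrArg (proj N) (hp n)
  simp only [map_mul, map_add, map_smul, map_pow] at h1
  rw [mul_smul_comm, smul_mul_assoc, h1, ← smul_sub, add_sub_cancel_left, smul_smul,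
    mul_smul_comm]
  congr 1
  have hn : 1 / ((n + 1).factorial : ℝ) * (n + 1 : ℕ) = 1 / (n.factorial : ℝ) := by
    rw [Nat.factorial_succ]
    push_cast
    field_simp
  rw [mul_right_comm, ← sc_natCast, ← sc_mul, hn]

/-- `exp (τ x) y exp (-τ x) = ∑ n, τ ^ n ad(x) ^ n y / n!`, when `ad(x) ^ 3 y = 0`. -/
theorem expT_mul_of_lie {x y₀ y₁ y₂ : Hat A} (h₀ : ⁅x, y₀⁆ = y₁) (h₁ : ⁅x, y₁⁆ = (2 : Rtau) • y₂)
    (h₂ : Commute x y₂) :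
    expT x * y₀ = (y₀ + tau • y₁ + tau ^ 2 • y₂) * expT x := by
  rw [Ring.lie_def, sub_eq_iff_eq_add] at h₀ h₁
  have hp1 : ∀ n : ℕ, x ^ (n + 1) * y₁ = y₁ * x ^ (n + 1) +
      ((2 * (n + 1) : ℕ) : Rtau) • (y₂ * x ^ n) := by
    intro n
    induction n with
    | zero => simp [h₁, add_comm]
    | succ n ih =>
      rw [pow_succ' x (n + 1), mul_assoc, ih, mul_add, ← mul_assoc, h₁, mul_smul_comm,
        ← mul_assoc, h₂.eq, mul_assoc y₂, ← pow_succ', add_mul, mul_assoc, ← pow_succ' x (n + 1),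
        smul_mul_assoc, add_comm (_ • _), add_assoc, ← add_smul]
      congr 2
      push_cast
      ring
  have hp : ∀ n : ℕ, x ^ (n + 2) * y₀ = y₀ * x ^ (n + 2) +
      ((n + 2 : ℕ) : Rtau) • (y₁ * x ^ (n + 1)) +
      (((n + 2) * (n + 1) : ℕ) : Rtau) • (y₂ * x ^ n) := by
    intro n
    induction n with
    | zero =>
      rw [zero_add, pow_two, mul_assoc, h₀, mul_add, ← mul_assoc, h₀, h₁]
      simp only [add_mul, mul_assoc]
      simp [two_smul]
      abel
    | succ n ih =>
      rw [pow_succ x (n + 2), mul_assoc, h₀, mul_add, ← mul_assoc, ih, hp1 (n + 1)]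
      simp only [add_mul, mul_add, smul_mul_assoc, mul_assoc, ← pow_succ]
      rw [show n + 1 + 1 = n + 2 from rfl, show n + 1 + 2 = n + 3 from rfl]
      simp only [Nat.cast_add, Nat.cast_mul, Nat.cast_one, Nat.cast_ofNat]
      -- `module` needs the canonical `ℕ`-algebra structure, whereas instance search prefers the
      -- one that power series inherit from their coefficients.
      let _ : Algebra ℕ Rtau := Semiring.toNatAlgebra
      module
  refine hat_ext fun N => ?_
  have e0 : proj N (expT x) = _ := proj_tauSeries_of_le _ x (le_refl N)
  have e1 : proj N (expT x) = _ := proj_tauSeries_of_le _ x (Nat.le_succ N)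
  have e2 : proj N (expT x) = _ := proj_tauSeries_of_le _ x (Nat.le_add_right N 2)
  have hs : ∀ k n m : ℕ, (n + k).factorial = m * n.factorial →
      sc (1 / ((n + k).factorial : ℝ)) * tau ^ (n + k) * (m : Rtau) =
        tau ^ k * (sc (1 / (n.factorial : ℝ)) * tau ^ n) := by
    intro k n m hm
    rw [pow_add, ← sc_natCast, mul_right_comm, ← sc_mul, hm]
    have hm0 : (m : ℝ) ≠ 0 := by
      rintro h
      have := Nat.factorial_ne_zero (n + k)
      rw [hm, Nat.cast_eq_zero.1 h, zero_mul] at this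
      exact this rfl
    have : 1 / ((m * n.factorial : ℕ) : ℝ) * m = 1 / (n.factorial : ℝ) := by
      push_cast; field_simp
    rw [this]
    ring
  have hp' : ∀ n : ℕ, (sc (1 / ((n + 2).factorial : ℝ)) * tau ^ (n + 2)) •
        (proj N x ^ (n + 2) * proj N y₀) =
      (sc (1 / ((n + 2).factorial : ℝ)) * tau ^ (n + 2)) • (proj N y₀ * proj N x ^ (n + 2)) +
      tau • (sc (1 / ((n + 1).factorial : ℝ)) * tau ^ (n + 1)) • (proj N y₁ * proj N x ^ (n + 1)) +
      tau ^ 2 • (sc (1 / (n.factorial : ℝ)) * tau ^ n) • (proj N y₂ * proj N x ^ n) := by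
    intro n
    have h1 := congrArg (proj N) (hp n)
    simp only [map_mul, map_add, map_smul, map_pow] at h1
    have hs1 := hs 1 (n + 1) (n + 2) (Nat.factorial_succ (n + 1))
    have hs2 := hs 2 n ((n + 2) * (n + 1)) (by
      rw [Nat.factorial_succ, Nat.factorial_succ, mul_assoc])
    rw [pow_one, add_assoc] at hs1
    rw [h1, smul_add, smul_add, smul_smul, smul_smul, smul_smul, smul_smul, hs1, hs2]
  have hx := congrArg (proj N) h₀
  simp only [map_mul, map_add] at hx
  simp only [map_mul, map_add, map_smul, add_mul, smul_mul_assoc]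
  conv_rhs =>
    congr
    · congr
      · rw [e2]
      · rw [e1]
    · rw [e0]
  rw [e2, Finset.sum_range_succ', Finset.sum_range_succ', Finset.sum_range_succ' _ N]
  simp only [add_mul, mul_add, Finset.mul_sum, Finset.sum_mul, smul_mul_assoc, mul_smul_comm,
    add_assoc, Nat.reduceAdd, hp', Finset.sum_add_distrib, smul_add, Finset.smul_sum]
  simp only [Nat.factorial_zero, Nat.factorial_one, Nat.cast_one, div_one, sc_one,
    pow_zero, pow_one, one_mul, mul_one, one_smul, hx, smul_add]
  abel

end Complete

/-! ### Embeddings into completed tensor powers -/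

section TensorMaps

variable {A : Type} [Ring A] [Algebra Rtau A] {B : Type} [Ring B] [Algebra Rtau B]

/-- `a ↦ a ⊗ 1`. -/
def in1 : A →ₐ[Rtau] Hat2 A := toHat.comp Algebra.TensorProduct.includeLeft

/-- `a ↦ 1 ⊗ a`. -/
def in2 : A →ₐ[Rtau] Hat2 A := toHat.comp Algebra.TensorProduct.includeRight

theorem tens_eq (a b : A) : tens a b = in1 a * in2 b := by
  simp [tens, in1, in2, ← map_mul]

theorem commute_in (a b : A) : Commute (in1 a) (in2 b) := by
  refine Commute.map ?_ (toHat : A ⊗[Rtau] A →ₐ[Rtau] Hat2 A)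
  simp [Commute, SemiconjBy]

theorem hat2_hom_ext {f g : Hat2 A →ₐ[Rtau] Hat B} (h1 : ∀ a, f (in1 a) = g (in1 a))
    (h2 : ∀ a, f (in2 a) = g (in2 a)) : f = g := by
  refine hat_hom_ext fun t => ?_
  induction t with
  | zero => simp
  | tmul a b =>
    change f (tens a b) = g (tens a b)
    rw [tens_eq, map_mul, map_mul, h1, h2]
  | add s t hs ht => simp [hs, ht]

@[simp] theorem pairMap_in1 (f g : A →ₐ[Rtau] Hat B) (h : ∀ x y, Commute (f x) (g y)) (a : A) :
    pairMap f g h (in1 a) = f a := by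
  change pairMap f g h (toHat _) = _
  rw [pairMap, extHat_toHat]
  simp

@[simp] theorem pairMap_in2 (f g : A →ₐ[Rtau] Hat B) (h : ∀ x y, Commute (f x) (g y)) (a : A) :
    pairMap f g h (in2 a) = g a := by
  change pairMap f g h (toHat _) = _
  rw [pairMap, extHat_toHat]
  simp

@[simp] theorem leg12_in1 (a : A) : leg12 (in1 a) = slot1 a := pairMap_in1 _ _ _ a
@[simp] theorem leg12_in2 (a : A) : leg12 (in2 a) = slot2 a := pairMap_in2 _ _ _ a
@[simp] theorem leg13_in1 (a : A) : leg13 (in1 a) = slot1 a := pairMap_in1 _ _ _ a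
@[simp] theorem leg13_in2 (a : A) : leg13 (in2 a) = slot3 a := pairMap_in2 _ _ _ a
@[simp] theorem leg23_in1 (a : A) : leg23 (in1 a) = slot2 a := pairMap_in1 _ _ _ a
@[simp] theorem leg23_in2 (a : A) : leg23 (in2 a) = slot3 a := pairMap_in2 _ _ _ a

@[simp] theorem deltaId_in1 (Δ : A →ₐ[Rtau] Hat2 A) (a : A) :
    deltaId Δ (in1 a) = leg12 (Δ a) := pairMap_in1 _ _ _ a
@[simp] theorem deltaId_in2 (Δ : A →ₐ[Rtau] Hat2 A) (a : A) :
    deltaId Δ (in2 a) = slot3 a := pairMap_in2 _ _ _ a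
@[simp] theorem idDelta_in1 (Δ : A →ₐ[Rtau] Hat2 A) (a : A) :
    idDelta Δ (in1 a) = slot1 a := pairMap_in1 _ _ _ a
@[simp] theorem idDelta_in2 (Δ : A →ₐ[Rtau] Hat2 A) (a : A) :
    idDelta Δ (in2 a) = leg23 (Δ a) := pairMap_in2 _ _ _ a

@[simp] theorem flipHat_in1 (a : A) : flipHat (in1 a) = in2 a := by
  change flipHat (toHat _) = _
  rw [flipHat, extHat_toHat]
  simp [in2]

@[simp] theorem flipHat_in2 (a : A) : flipHat (in2 a) = in1 a := by
  change flipHat (toHat _) = _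
  rw [flipHat, extHat_toHat]
  simp [in1]

@[simp] theorem flipHat_flipHat (z : Hat2 A) : flipHat (flipHat z) = z := by
  have h : (flipHat (A := A)).comp flipHat = AlgHom.id Rtau _ :=
    hat2_hom_ext (by simp) (by simp)
  exact AlgHom.congr_fun h z

@[simp] theorem epsId_in1 (ε : A →ₐ[Rtau] Rtau) (a : A) :
    epsId ε (in1 a) = algebraMap Rtau _ (ε a) := by
  change epsId ε (toHat _) = _
  rw [epsId, extHat_toHat]
  refine (congrArg toHat (Algebra.TensorProduct.lift_tmul ((Algebra.ofId Rtau A).comp ε)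
    (AlgHom.id Rtau A) (fun x y => Algebra.commutes (ε x) y) _ _)).trans ?_
  simp [Algebra.ofId_apply]

@[simp] theorem epsId_in2 (ε : A →ₐ[Rtau] Rtau) (a : A) : epsId ε (in2 a) = toHat a := by
  change epsId ε (toHat _) = _
  rw [epsId, extHat_toHat]
  refine (congrArg toHat (Algebra.TensorProduct.lift_tmul ((Algebra.ofId Rtau A).comp ε)
    (AlgHom.id Rtau A) (fun x y => Algebra.commutes (ε x) y) _ _)).trans ?_
  simp

@[simp] theorem idEps_in1 (ε : A →ₐ[Rtau] Rtau) (a : A) : idEps ε (in1 a) = toHat a := by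
  change idEps ε (toHat _) = _
  rw [idEps, extHat_toHat]
  refine (congrArg toHat (Algebra.TensorProduct.lift_tmul (AlgHom.id Rtau A)
    ((Algebra.ofId Rtau A).comp ε) (fun x y => (Algebra.commutes (ε y) x).symm) _ _)).trans ?_
  simp

@[simp] theorem idEps_in2 (ε : A →ₐ[Rtau] Rtau) (a : A) :
    idEps ε (in2 a) = algebraMap Rtau _ (ε a) := by
  change idEps ε (toHat _) = _
  rw [idEps, extHat_toHat]
  refine (congrArg toHat (Algebra.TensorProduct.lift_tmul (AlgHom.id Rtau A)
    ((Algebra.ofId Rtau A).comp ε) (fun x y => (Algebra.commutes (ε y) x).symm) _ _)).trans ?_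
  simp [Algebra.ofId_apply]

/-- The algebra map `a ⊗ b ⊗ c ↦ f a * g b * h c` on the completed tensor cube, for algebra maps
with pairwise commuting ranges. -/
def tripleMap (f g h : A →ₐ[Rtau] Hat B) (hfg : ∀ x y, Commute (f x) (g y))
    (hfh : ∀ x y, Commute (f x) (h y)) (hgh : ∀ x y, Commute (g x) (h y)) :
    Hat3 A →ₐ[Rtau] Hat B :=
  extHat (Algebra.TensorProduct.lift (Algebra.TensorProduct.lift f g hfg) h fun t z => by
    induction t with
    | zero => rw [map_zero]; exact Commute.zero_left _
    | tmul a b => rw [Algebra.TensorProduct.lift_tmul]; exact (hfh a z).mul_left (hgh b z)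
    | add s t hs ht => rw [map_add]; exact hs.add_left ht)

section

variable (f g h : A →ₐ[Rtau] Hat B) (hfg : ∀ x y, Commute (f x) (g y))
    (hfh : ∀ x y, Commute (f x) (h y)) (hgh : ∀ x y, Commute (g x) (h y)) (a : A)

@[simp] theorem tripleMap_slot1 : tripleMap f g h hfg hfh hgh (slot1 a) = f a := by
  change tripleMap f g h hfg hfh hgh (toHat _) = _
  rw [tripleMap, extHat_toHat]
  simp

@[simp] theorem tripleMap_slot2 : tripleMap f g h hfg hfh hgh (slot2 a) = g a := by
  change tripleMap f g h hfg hfh hgh (toHat _) = _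
  rw [tripleMap, extHat_toHat]
  simp

@[simp] theorem tripleMap_slot3 : tripleMap f g h hfg hfh hgh (slot3 a) = h a := by
  change tripleMap f g h hfg hfh hgh (toHat _) = _
  rw [tripleMap, extHat_toHat]
  simp

end

/-- The cyclic permutation `a ⊗ b ⊗ c ↦ c ⊗ a ⊗ b`. -/
def cycHat : Hat3 A →ₐ[Rtau] Hat3 A :=
  tripleMap slot2 slot3 slot1 commute23 (fun x y => (commute12 y x).symm)
    (fun x y => (commute13 y x).symm)

/-- The transposition `a ⊗ b ⊗ c ↦ b ⊗ a ⊗ c`. -/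
def swapHat : Hat3 A →ₐ[Rtau] Hat3 A :=
  tripleMap slot2 slot1 slot3 (fun x y => (commute12 y x).symm) commute23 commute13

theorem idDelta_eq_cycHat (Δ : A →ₐ[Rtau] Hat2 A) (z : Hat2 A) :
    idDelta Δ z = cycHat (deltaId Δ (flipHat z)) := by
  have h12 : (cycHat (A := A)).comp leg12 = leg23 :=
    hat2_hom_ext (by simp [cycHat]) (by simp [cycHat])
  have h : idDelta Δ = cycHat.comp ((deltaId Δ).comp flipHat) :=
    hat2_hom_ext (by simp [cycHat]) (fun a => by
      simpa using (AlgHom.congr_fun h12 (Δ a)).symm)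
  exact AlgHom.congr_fun h z

theorem cycHat_leg23 (z : Hat2 A) : cycHat (leg23 z) = leg13 (flipHat z) := by
  have h : (cycHat (A := A)).comp leg23 = leg13.comp flipHat :=
    hat2_hom_ext (by simp [cycHat]) (by simp [cycHat])
  exact AlgHom.congr_fun h z

theorem cycHat_leg13 (z : Hat2 A) : cycHat (leg13 z) = leg12 (flipHat z) := by
  have h : (cycHat (A := A)).comp leg13 = leg12.comp flipHat :=
    hat2_hom_ext (by simp [cycHat]) (by simp [cycHat])
  exact AlgHom.congr_fun h z

theorem swapHat_leg12 (z : Hat2 A) : swapHat (leg12 z) = leg12 (flipHat z) := by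
  have h : (swapHat (A := A)).comp leg12 = leg12.comp flipHat :=
    hat2_hom_ext (by simp [swapHat]) (by simp [swapHat])
  exact AlgHom.congr_fun h z

theorem swapHat_leg13 (z : Hat2 A) : swapHat (leg13 z) = leg23 z := by
  have h : (swapHat (A := A)).comp leg13 = leg23 :=
    hat2_hom_ext (by simp [swapHat]) (by simp [swapHat])
  exact AlgHom.congr_fun h z

theorem swapHat_leg23 (z : Hat2 A) : swapHat (leg23 z) = leg13 z := by
  have h : (swapHat (A := A)).comp leg23 = leg13 :=
    hat2_hom_ext (by simp [swapHat]) (by simp [swapHat])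
  exact AlgHom.congr_fun h z

/-- Conjugation by a unit, as an algebra map. -/
def conjHom (u : (Hat B)ˣ) : Hat B →ₐ[Rtau] Hat B where
  toFun z := u.val * z * u⁻¹.val
  map_one' := by simp
  map_mul' x y := by simp [mul_assoc]
  map_zero' := by simp
  map_add' x y := by simp [mul_add, add_mul]
  commutes' r := by rw [← Algebra.commutes, mul_assoc, Units.mul_inv, mul_one]

theorem conjHom_apply (u : (Hat B)ˣ) (z : Hat B) : conjHom u z = u.val * z * u⁻¹.val := rfl

end TensorMaps

/-! ### Formal consequences of the first hexagon identity -/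

section RMatrixIdentities

variable {A : Type} [Ring A] [Algebra Rtau A] {Δ : A →ₐ[Rtau] Hat2 A} {R : (Hat2 A)ˣ}

/-- For a triangular element, the second hexagon identity is a cyclic permutation of the inverse
of the first. -/
theorem id_delta_of_delta_id (hR : flipHat R.val = R⁻¹.val)
    (h : deltaId Δ R.val = leg13 R.val * leg23 R.val) :
    idDelta Δ R.val = leg13 R.val * leg12 R.val := by
  have hinv : deltaId Δ R⁻¹.val = leg23 R⁻¹.val * leg13 R⁻¹.val := by
    have h1 : deltaId Δ R⁻¹.val * deltaId Δ R.val = 1 := by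
      rw [← map_mul, Units.inv_mul, map_one]
    refine left_inv_eq_right_inv h1 ?_
    rw [h, mul_assoc, ← mul_assoc (leg23 _) (leg23 _), ← map_mul, Units.mul_inv, map_one,
      one_mul, ← map_mul, Units.mul_inv, map_one]
  rw [idDelta_eq_cycHat, hR, hinv, map_mul, cycHat_leg23, cycHat_leg13, ← hR, flipHat_flipHat]

/-- The quantum Yang–Baxter equation is the conjugation identity applied to the first leg of
`R`, combined with the first hexagon identity. -/
theorem yangBaxter_of_conj (hc : ∀ x, R.val * Δ x * R⁻¹.val = flipHat (Δ x))
    (h : deltaId Δ R.val = leg13 R.val * leg23 R.val) : YangBaxter R.val := by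
  have key : (conjHom (Units.map (leg12 (A := A) : Hat2 A →* Hat3 A) R)).comp (deltaId Δ) =
      swapHat.comp (deltaId Δ) := by
    refine hat2_hom_ext (fun a => ?_) (fun a => ?_)
    · simp only [AlgHom.comp_apply, deltaId_in1, swapHat_leg12, ← hc, map_mul]
      rfl
    · simp only [AlgHom.comp_apply, deltaId_in2, conjHom_apply]
      have hcomm : Commute (leg12 R.val) (slot3 a) :=
        pairMap_commute _ _ _ _ (fun b => commute13 b a) (fun b => commute23 b a) _
      change leg12 R.val * slot3 a * leg12 R⁻¹.val = _
      rw [hcomm.eq, mul_assoc, ← map_mul, Units.mul_inv, map_one, mul_one]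
      simp [swapHat]
  have h1 := AlgHom.congr_fun key R.val
  simp only [AlgHom.comp_apply, h, map_mul, swapHat_leg13, swapHat_leg23] at h1
  have h2 : leg12 R.val * (leg13 R.val * leg23 R.val) * leg12 R⁻¹.val =
      leg23 R.val * leg13 R.val := by
    rw [← h1, ← map_mul]; rfl
  rw [YangBaxter, ← h2, mul_assoc _ (leg12 R⁻¹.val), ← map_mul, Units.inv_mul, map_one, mul_one,
    mul_assoc]

end RMatrixIdentities

/-! ### Realisations of the deformed commutation rules -/

section Realisations

variable {B : Type} [Ring B] [Algebra Rtau B] {B' : Type} [Ring B'] [Algebra Rtau B']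

/-- Six elements of a completed algebra that satisfy the deformed commutation rules. -/
structure IsRep (μ ν : ℝ) (x : Gen → Hat B) : Prop where
  KH : ⁅x .K, x .H⁆ = sc ν • (expT (-x .H) * x .P)
  KP : ⁅x .K, x .P⁆ = sc μ • expDivT (x .H)
  HP : ⁅x .H, x .P⁆ = 0
  KD : ⁅x .K, x .D⁆ = 0
  DH : ⁅x .D, x .H⁆ = -expDivT (-x .H)
  DC₁ : ⁅x .D, x .C₁⁆ = -x .C₁ + (tau * sc ν) • x .D ^ 2
  HC₁ : ⁅x .H, x .C₁⁆ = -(sc (2 * ν) • x .D)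
  DP : ⁅x .D, x .P⁆ = x .P
  DC₂ : ⁅x .D, x .C₂⁆ = -x .C₂
  PC₂ : ⁅x .P, x .C₂⁆ = sc (2 * μ) • x .D
  KC₁ : ⁅x .K, x .C₁⁆ = sc ν • x .C₂
  KC₂ : ⁅x .K, x .C₂⁆ = sc μ • x .C₁ - (tau * sc (μ * ν)) • x .D ^ 2
  HC₂ : ⁅x .H, x .C₂⁆ = expT (-x .H) * x .K + x .K * expT (-x .H)
  PC₁ : ⁅x .P, x .C₁⁆ = -(2 * x .K) - (tau * sc ν) • (x .D * x .P + x .P * x .D)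
  C₁C₂ : ⁅x .C₁, x .C₂⁆ = -((tau * sc ν) • (x .D * x .C₂ + x .C₂ * x .D))

variable {μ ν : ℝ}

theorem map_bracket (f : B →ₐ[Rtau] B') (a b : B) : f ⁅a, b⁆ = ⁅f a, f b⁆ := by
  simp [Ring.lie_def]

theorem IsRep.map {x : Gen → Hat B} (hx : IsRep μ ν x) (f : Hat B →ₐ[Rtau] Hat B') :
    IsRep μ ν (fun g => f (x g)) := by
  constructor <;>
    simp only [← map_bracket, ← map_neg, ← map_expT, ← map_expDivT, ← map_mul, ← map_smul,
      ← map_add, ← map_sub, ← map_pow, hx.KH, hx.KP, hx.HP, hx.KD, hx.DH, hx.DC₁, hx.HC₁, hx.DP,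
      hx.DC₂, hx.PC₂, hx.KC₁, hx.KC₂, hx.HC₂, hx.PC₁, hx.C₁C₂, map_zero]
  simp only [map_sub, map_neg, map_mul, map_ofNat]

theorem isRep_iff_map_eq (φ : Free →ₐ[Rtau] Hat B) :
    IsRep μ ν (fun g => φ (fr g)) ↔ ∀ x y, Rel μ ν x y → φ x = φ y := by
  constructor
  · rintro h x y hxy
    cases hxy <;>
      simp only [map_bracket, map_neg, map_expT, map_expDivT, map_mul, map_smul, map_add,
        map_sub, map_pow, map_zero, map_ofNat, h.KH, h.KP, h.HP, h.KD, h.DH, h.DC₁, h.HC₁, h.DP,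
        h.DC₂, h.PC₂, h.KC₁, h.KC₂, h.HC₂, h.PC₁, h.C₁C₂]
  · intro h
    constructor
    · simpa only [map_bracket, map_neg, map_expT, map_mul, map_smul] using h _ _ .KH
    · simpa only [map_bracket, map_expDivT, map_smul] using h _ _ .KP
    · simpa only [map_bracket, map_zero] using h _ _ .HP
    · simpa only [map_bracket, map_zero] using h _ _ .KD
    · simpa only [map_bracket, map_neg, map_expDivT] using h _ _ .DH
    · simpa only [map_bracket, map_neg, map_add, map_smul, map_pow] using h _ _ .DC₁
    · simpa only [map_bracket, map_neg, map_smul] using h _ _ .HC₁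
    · simpa only [map_bracket] using h _ _ .DP
    · simpa only [map_bracket, map_neg] using h _ _ .DC₂
    · simpa only [map_bracket, map_smul] using h _ _ .PC₂
    · simpa only [map_bracket, map_smul] using h _ _ .KC₁
    · simpa only [map_bracket, map_sub, map_smul, map_pow] using h _ _ .KC₂
    · simpa only [map_bracket, map_neg, map_expT, map_mul, map_add] using h _ _ .HC₂
    · simpa only [map_bracket, map_neg, map_sub, map_smul, map_mul, map_add, map_ofNat]
        using h _ _ .PC₁
    · simpa only [map_bracket, map_neg, map_smul, map_mul, map_add] using h _ _ .C₁C₂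

theorem isRep_gen (μ ν : ℝ) : IsRep μ ν (gen μ ν) := by
  refine (isRep_iff_map_eq (toHat.comp (quo μ ν))).2 fun x y h => ?_
  exact congrArg toHat (RingQuot.mkAlgHom_rel Rtau h)

/-- The restriction of `lift` to the algebra before completion. -/
def liftUAlg {x : Gen → Hat B} (hx : IsRep μ ν x) : UAlg μ ν →ₐ[Rtau] Hat B :=
  RingQuot.liftAlgHom Rtau ⟨extHat (FreeAlgebra.lift Rtau x), by
    refine (isRep_iff_map_eq _).1 ?_
    simpa only [fr, extHat_toHat, FreeAlgebra.lift_ι_apply] using hx⟩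

/-- The algebra map from the quantum algebra determined by a realisation of the deformed
commutation rules. -/
def lift {x : Gen → Hat B} (hx : IsRep μ ν x) : U μ ν →ₐ[Rtau] Hat B := extHat (liftUAlg hx)

theorem lift_gen {x : Gen → Hat B} (hx : IsRep μ ν x) (g : Gen) : lift hx (gen μ ν g) = x g := by
  rw [lift, gen, extHat_toHat]
  refine (RingQuot.liftAlgHom_mkAlgHom_apply _ _ _ _).trans ?_
  rw [fr, extHat_toHat, FreeAlgebra.lift_ι_apply]

theorem U_hom_ext {f g : U μ ν →ₐ[Rtau] Hat B} (h : ∀ X, f (gen μ ν X) = g (gen μ ν X)) :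
    f = g := by
  refine hat_hom_ext fun a => ?_
  obtain ⟨b, rfl⟩ := RingQuot.mkAlgHom_surjective Rtau (Rel μ ν) a
  have key : (f.comp (toHat.comp (quo μ ν))) = (g.comp (toHat.comp (quo μ ν))) := by
    refine hat_hom_ext fun c => ?_
    have : (f.comp (toHat.comp (quo μ ν))).comp toHat =
        (g.comp (toHat.comp (quo μ ν))).comp toHat := FreeAlgebra.hom_ext (funext h)
    exact AlgHom.congr_fun this c
  exact AlgHom.congr_fun key b

/-- `ℝ⟦τ⟧` is its own `τ`-adic completion. -/
theorem toHat_Rtau_bijective : Function.Bijective (toHat : Rtau →ₐ[Rtau] Hat Rtau) := by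
  constructor
  · rw [injective_iff_map_eq_zero]
    intro r hr
    ext n
    obtain ⟨c, hc⟩ := (mk_eq_zero_iff (n + 1) r).1 (by rw [hr, map_zero])
    rw [hc, smul_eq_mul, tau, PowerSeries.coeff_X_pow_mul', if_neg (by omega)]
    simp
  · intro x
    choose a ha using fun k => exists_proj_toHat (A := Rtau) k x
    refine ⟨PowerSeries.mk fun n => PowerSeries.coeff n (a (n + 1)), hat_ext fun N => ?_⟩
    rw [ha N, mk_eq_iff]
    have hd : (PowerSeries.X : Rtau) ^ N ∣
        PowerSeries.mk (fun n => PowerSeries.coeff n (a (n + 1))) - a N := by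
      rw [PowerSeries.X_pow_dvd_iff]
      intro m hm
      have h1 := proj_eq_of_le (Nat.succ_le_of_lt hm) (ha N)
      rw [ha (m + 1)] at h1
      obtain ⟨c, hc⟩ := (mk_eq_iff _ _ _).1 h1
      rw [map_sub, PowerSeries.coeff_mk, hc, map_add, smul_eq_mul, tau,
        PowerSeries.coeff_X_pow_mul', if_neg (by omega), add_zero, sub_self]
    obtain ⟨c, hc⟩ := hd
    exact ⟨c, by rw [smul_eq_mul, tau, ← hc]; ring⟩

theorem isRep_zero : IsRep μ ν (fun _ => (0 : Hat B)) := by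
  constructor <;> simp [Ring.lie_def]

/-- The counit: the algebra map to `ℝ⟦τ⟧` that vanishes on the generators. -/
def counit (μ ν : ℝ) : U μ ν →ₐ[Rtau] Rtau :=
  (AlgEquiv.ofBijective _ toHat_Rtau_bijective).symm.toAlgHom.comp
    (lift (isRep_zero (μ := μ) (ν := ν)))

theorem counit_gen (g : Gen) : counit μ ν (gen μ ν g) = 0 := by
  simp [counit, lift_gen]

end Realisations

/-! ### The twist by `exp (τ D ⊗ H)` -/

section Twist

variable {B : Type} [Ring B] [Algebra Rtau B] {μ ν : ℝ}

theorem mul_bracket (a b c : Hat B) : ⁅a * b, c⁆ = a * ⁅b, c⁆ + ⁅a, c⁆ * b := by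
  simp only [Ring.lie_def]; noncomm_ring

theorem bracket_mul (a b c : Hat B) : ⁅a, b * c⁆ = ⁅a, b⁆ * c + b * ⁅a, c⁆ := by
  simp only [Ring.lie_def]; noncomm_ring

theorem add_bracket (a b c : Hat B) : ⁅a + b, c⁆ = ⁅a, c⁆ + ⁅b, c⁆ := by
  simp only [Ring.lie_def]; noncomm_ring

theorem sub_bracket (a b c : Hat B) : ⁅a - b, c⁆ = ⁅a, c⁆ - ⁅b, c⁆ := by
  simp only [Ring.lie_def]; noncomm_ring

theorem bracket_add (a b c : Hat B) : ⁅a, b + c⁆ = ⁅a, b⁆ + ⁅a, c⁆ := by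
  simp only [Ring.lie_def]; noncomm_ring

theorem bracket_sub (a b c : Hat B) : ⁅a, b - c⁆ = ⁅a, b⁆ - ⁅a, c⁆ := by
  simp only [Ring.lie_def]; noncomm_ring

theorem bracket_neg (a b : Hat B) : ⁅a, -b⁆ = -⁅a, b⁆ := by
  simp only [Ring.lie_def]; noncomm_ring

theorem smul_bracket (r : Rtau) (a b : Hat B) : ⁅r • a, b⁆ = r • ⁅a, b⁆ := by
  simp only [Ring.lie_def, smul_mul_assoc, mul_smul_comm, smul_sub]

theorem bracket_smul (r : Rtau) (a b : Hat B) : ⁅a, r • b⁆ = r • ⁅a, b⁆ := by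
  simp only [Ring.lie_def, smul_mul_assoc, mul_smul_comm, smul_sub]

theorem sc_two_mul (r : ℝ) : sc (2 * r) = 2 * sc r := by
  rw [sc_mul]; congr 1

theorem bracket_swap {a b c : Hat B} (h : ⁅a, b⁆ = c) : ⁅b, a⁆ = -c := by
  rw [← h, Ring.lie_def, Ring.lie_def, neg_sub]

theorem bracket_expT (z w : Hat B) : ⁅z, expT w⁆ = tau • ⁅z, expDivT w⁆ := by
  rw [expT_eq, bracket_add, bracket_smul]
  simp [Ring.lie_def]

variable {x y : Gen → Hat B}

/-- The element `(exp (τ H) - 1) / τ` is a weight vector for `D`, as `H` is before deformation. -/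
theorem IsRep.D_expDivT_H (hx : IsRep μ ν x) : ⁅x .D, expDivT (x .H)⁆ = expDivT (x .H) := by
  rw [lie_expDivT hx.DH, neg_mul, expDivT_neg, neg_neg]
  exact (commute_expDivT (Commute.refl (x .H)).neg_right).symm.neg_left

theorem IsRep.D_expT_neg_H (hx : IsRep μ ν x) :
    ⁅x .D, expT (-x .H)⁆ = expT (-x .H) * expT (-x .H) - expT (-x .H) := by
  have h1 : ⁅x .D, -x .H⁆ = expDivT (-x .H) := by rw [bracket_neg, hx.DH, neg_neg]
  rw [bracket_expT, lie_expDivT h1 (commute_expDivT (Commute.refl _)).symm, ← smul_mul_assoc,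
    ← sub_eq_iff_eq_add'.2 (expT_eq (-x .H)), sub_mul, one_mul]

theorem IsRep.commute_HP (hx : IsRep μ ν x) : Commute (x .H) (x .P) := commute_iff_lie_eq.2 hx.HP

theorem IsRep.commute_expT_P (hx : IsRep μ ν x) (r : Rtau) : Commute (expT (r • x .H)) (x .P) :=
  (commute_expT (hx.commute_HP.smul_left r).symm).symm

theorem IsRep.K_expT_neg_H (hx : IsRep μ ν x) : ⁅x .K, expT (-x .H)⁆ =
    -((tau * sc ν) • (expT (-x .H) * (expT (-x .H) * x .P))) := by
  have h1 : ⁅x .K, -x .H⁆ = -(sc ν • (expT (-x .H) * x .P)) := by rw [bracket_neg, hx.KH]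
  have he : Commute (expT (-x .H)) (x .P) := by simpa using hx.commute_expT_P (-1)
  have h2 : Commute (-(sc ν • (expT (-x .H) * x .P))) (-x .H) := by
    refine (Commute.smul_left (Commute.mul_left ?_ ?_) _).neg_left
    · exact (commute_expT (Commute.refl _)).symm
    · exact hx.commute_HP.symm.neg_right
  rw [bracket_expT, lie_expDivT h1 h2, neg_mul, smul_mul_assoc, smul_neg, smul_smul, mul_assoc,
    he.symm.eq]

/-- Conjugation of a `d`-weight vector by `exp (τ d h)`. -/
theorem semiconj_expT_weight {d h a : Hat B} {r : Rtau} (hdh : Commute d h) (hha : Commute h a)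
    (hda : ⁅d, a⁆ = r • a) : SemiconjBy (expT (d * h)) a (a * expT (r • h)) := by
  have h1 : SemiconjBy a (d * h + r • h) (d * h) := by
    rw [Ring.lie_def, sub_eq_iff_eq_add] at hda
    rw [SemiconjBy, mul_assoc d, hha.eq, ← mul_assoc d, hda, mul_add, add_mul, mul_smul_comm,
      smul_mul_assoc, mul_assoc, add_comm]
  have h2 : Commute (d * h) (r • h) := (hdh.mul_left (Commute.refl h)).smul_right r
  have h3 := semiconjBy_expT h1
  rw [expT_add h2] at h3
  rw [SemiconjBy, ← h3.eq, mul_assoc, (commute_expT (commute_expT h2).symm).eq]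

/-- The values of the deformed coproduct on the generators, for two commuting realisations `x`
and `y` in the place of `X ⊗ 1` and `1 ⊗ X`. -/
def coproductGen (ν : ℝ) (x y : Gen → Hat B) : Gen → Hat B
  | .H => y .H + x .H
  | .D => y .D + x .D * expT (-y .H)
  | .P => y .P + x .P * expT (y .H)
  | .C₁ => y .C₁ + x .C₁ * expT (-y .H)
  | .K => y .K + x .K - (tau * sc ν) • (x .D * (expT (-y .H) * y .P))
  | .C₂ => y .C₂ + x .C₂ * expT (-y .H) + (2 * tau) • (x .D * (expT (-y .H) * y .K))
      - (tau ^ 2 * sc ν) • ((x .D ^ 2 + x .D) * (expT (-(2 * y .H)) * y .P))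

/-- The coproduct before twisting: `(exp (τ H) - 1) / τ`, `P`, `K`, `D`, `C₂` and
`C₁ - τ ν D ^ 2` are primitive. The value at `H` is the one of `(exp (τ H) - 1) / τ`. -/
def untwistedGen (ν : ℝ) (x y : Gen → Hat B) : Gen → Hat B
  | .H => expDivT (y .H) + expDivT (x .H)
  | .C₁ => y .C₁ + x .C₁ + (tau * sc (2 * ν)) • (x .D * y .D)
  | g => y g + x g

theorem expT_neg_two_mul (h : Hat B) : expT (-(2 * h)) = expT (-h) * expT (-h) := by
  rw [← expT_add (Commute.refl _), two_mul, neg_add]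

theorem twist_H (hx : IsRep μ ν x) (hxy : ∀ i j, Commute (x i) (y j)) :
    SemiconjBy (expT (x .D * y .H)) (untwistedGen ν x y .H)
    (expDivT (coproductGen ν x y .H)) := by
  have h1 : Commute (x .D * y .H) (expDivT (y .H)) :=
    commute_expDivT ((hxy .D .H).mul_left (Commute.refl _))
  have h2 := semiconj_expT_weight (r := 1) (hxy .D .H) (commute_expDivT (hxy .H .H).symm)
    (by rw [hx.D_expDivT_H, one_smul])
  have h3 := SemiconjBy.add_right (commute_expT h1.symm).symm h2
  rw [one_smul] at h3
  simp only [untwistedGen, coproductGen]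
  rw [expDivT_add (hxy .H .H).symm]
  rwa [(commute_expT (commute_expDivT (hxy .H .H).symm).symm).eq] at h3

theorem twist_P (hx : IsRep μ ν x) (hy : IsRep μ ν y) (hxy : ∀ i j, Commute (x i) (y j)) :
    SemiconjBy (expT (x .D * y .H)) (untwistedGen ν x y .P)
    (coproductGen ν x y .P) := by
  have h1 : Commute (x .D * y .H) (y .P) := (hxy .D .P).mul_left hy.commute_HP
  have h2 := semiconj_expT_weight (r := 1) (hxy .D .H) (hxy .P .H).symm
    (by rw [hx.DP, one_smul])
  rw [one_smul] at h2
  exact SemiconjBy.add_right (commute_expT h1.symm).symm h2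

/-- The conjugate of `1 ⊗ D` by the twist. -/
theorem twist_D_right (hy : IsRep μ ν y) (hxy : ∀ i j, Commute (x i) (y j)) :
    SemiconjBy (expT (x .D * y .H)) (y .D)
    (y .D + x .D * (expT (-y .H) - 1)) := by
  have h0 : ⁅x .D * y .H, y .D⁆ = x .D * expDivT (-y .H) := by
    rw [mul_bracket, bracket_swap hy.DH, commute_iff_lie_eq.1 (hxy .D .D), zero_mul, add_zero,
      neg_neg]
  have h1 : ⁅x .D * y .H, x .D * expDivT (-y .H)⁆ = (2 : Rtau) • (0 : Hat B) := by
    rw [smul_zero, ← commute_iff_lie_eq]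
    have h3 : Commute (y .H) (expDivT (-y .H)) := commute_expDivT (Commute.refl _).neg_right
    have h4 : Commute (x .D) (expDivT (-y .H)) := commute_expDivT (hxy _ _).neg_right
    exact ((Commute.refl _).mul_right h4).mul_left ((hxy .D .H).symm.mul_right h3)
  have h2 := expT_mul_of_lie h0 h1 (Commute.zero_right _)
  rw [smul_zero, add_zero, ← mul_smul_comm, ← sub_eq_iff_eq_add'.2 (expT_eq (-y .H))] at h2
  exact h2

theorem commute_twist_D (hxy : ∀ i j, Commute (x i) (y j)) :
    Commute (expT (x .D * y .H)) (x .D) :=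
  (commute_expT ((Commute.refl _).mul_right (hxy _ _))).symm

theorem twist_D (hy : IsRep μ ν y) (hxy : ∀ i j, Commute (x i) (y j)) :
    SemiconjBy (expT (x .D * y .H)) (untwistedGen ν x y .D)
    (coproductGen ν x y .D) := by
  have h := (twist_D_right hy hxy).add_right (commute_twist_D hxy)
  simp only [untwistedGen, coproductGen]
  rwa [mul_sub, mul_one, add_assoc, sub_add_cancel] at h

theorem twist_K (hx : IsRep μ ν x) (hy : IsRep μ ν y) (hxy : ∀ i j, Commute (x i) (y j)) :
    SemiconjBy (expT (x .D * y .H)) (untwistedGen ν x y .K)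
    (coproductGen ν x y .K) := by
  have h0 : ⁅x .D * y .H, y .K⁆ = -(sc ν • (x .D * (expT (-y .H) * y .P))) := by
    rw [mul_bracket, bracket_swap hy.KH, commute_iff_lie_eq.1 (hxy .D .K), zero_mul, add_zero,
      mul_neg, mul_smul_comm]
  have hyH : Commute (y .H) (expT (-y .H) * y .P) :=
    (commute_expT (Commute.refl _).neg_right).mul_right hy.commute_HP
  have hxD : Commute (x .D) (expT (-y .H) * y .P) :=
    (commute_expT (hxy _ _).neg_right).mul_right (hxy _ _)
  have h1 : ⁅x .D * y .H, -(sc ν • (x .D * (expT (-y .H) * y .P)))⁆ =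
      (2 : Rtau) • (0 : Hat B) := by
    rw [smul_zero, ← commute_iff_lie_eq]
    exact ((((Commute.refl _).mul_right hxD).mul_left
      ((hxy .D .H).symm.mul_right hyH)).smul_right _).neg_right
  have h2 := expT_mul_of_lie h0 h1 (Commute.zero_right _)
  have h3 : Commute (expT (x .D * y .H)) (x .K) :=
    (commute_expT ((commute_iff_lie_eq.2 hx.KD).mul_right (hxy _ _))).symm
  have h4 := SemiconjBy.add_right h2 h3
  simp only [untwistedGen, coproductGen]
  rwa [smul_zero, add_zero, smul_neg, ← sub_eq_add_neg, smul_smul, sub_add_eq_add_sub] at h4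

theorem twist_C₁ (hx : IsRep μ ν x) (hy : IsRep μ ν y) (hxy : ∀ i j, Commute (x i) (y j)) :
    SemiconjBy (expT (x .D * y .H)) (untwistedGen ν x y .C₁)
    (coproductGen ν x y .C₁) := by
  have hD := commute_twist_D hxy
  -- `C₁ - τ ν D ^ 2` is a weight vector for `D`.
  have hw : ⁅x .D, x .C₁ - (tau * sc ν) • x .D ^ 2⁆ =
      (-1 : Rtau) • (x .C₁ - (tau * sc ν) • x .D ^ 2) := by
    rw [bracket_sub, hx.DC₁, bracket_smul, commute_iff_lie_eq.1 ((Commute.refl (x .D)).pow_right 2)]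
    simp only [neg_smul, one_smul, smul_zero]
    abel
  have hH : Commute (y .H) (x .C₁ - (tau * sc ν) • x .D ^ 2) :=
    (hxy _ _).symm.sub_right (((hxy _ _).symm.pow_right 2).smul_right _)
  have h1 := semiconj_expT_weight (hxy .D .H) hH hw
  rw [neg_smul, one_smul] at h1
  have h2 : SemiconjBy (expT (x .D * y .H)) ((tau * sc ν) • x .D ^ 2) ((tau * sc ν) • x .D ^ 2) :=
    (hD.pow_right 2).smul_right _
  have h3 := (h1.add_right h2)
  rw [sub_add_cancel] at h3
  have h4 : SemiconjBy (expT (x .D * y .H)) (x .D * y .D)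
      (x .D * (y .D + x .D * (expT (-y .H) - 1))) :=
    SemiconjBy.mul_right hD (twist_D_right hy hxy)
  have hHE : Commute (y .H) (expDivT (-y .H)) := commute_expDivT (Commute.refl _).neg_right
  have hDE : Commute (x .D) (expDivT (-y .H)) := commute_expDivT (hxy _ _).neg_right
  have h5 : ⁅x .D * y .H, y .C₁⁆ = -(sc (2 * ν) • (x .D * y .D)) := by
    rw [mul_bracket, hy.HC₁, commute_iff_lie_eq.1 (hxy .D .C₁), zero_mul, add_zero, mul_neg,
      mul_smul_comm]
  have h6 : ⁅x .D * y .H, -(sc (2 * ν) • (x .D * y .D))⁆ =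
      (2 : Rtau) • -(sc ν • (x .D ^ 2 * expDivT (-y .H))) := by
    rw [bracket_neg, bracket_smul, mul_bracket, bracket_mul, bracket_swap hy.DH, bracket_mul,
      commute_iff_lie_eq.1 (hxy .D .D), commute_iff_lie_eq.1 (Commute.refl (x .D)),
      commute_iff_lie_eq.1 (hxy .D .H).symm, sc_two_mul]
    simp only [neg_neg, zero_mul, mul_zero, zero_add, add_zero, smul_neg, mul_smul, pow_two,
      mul_assoc]
  have h7 : Commute (x .D * y .H) (-(sc ν • (x .D ^ 2 * expDivT (-y .H)))) := by
    refine Commute.neg_right (Commute.smul_right (Commute.mul_left ?_ ?_) _)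
    · exact ((Commute.refl _).pow_right 2).mul_right hDE
    · exact ((hxy .D .H).symm.pow_right 2).mul_right hHE
  have h8 := SemiconjBy.add_right (expT_mul_of_lie h5 h6 h7) h3
  have h9 : SemiconjBy (expT (x .D * y .H)) ((tau * sc (2 * ν)) • (x .D * y .D))
      ((tau * sc (2 * ν)) • (x .D * (y .D + x .D * (expT (-y .H) - 1)))) := by
    have := h4.eq
    rw [SemiconjBy, mul_smul_comm, this, ← smul_mul_assoc]
  have h10 := h8.add_right h9
  simp only [untwistedGen, coproductGen]
  convert h10 using 1
  have he : expT (-y .H) = 1 + tau • expDivT (-y .H) := expT_eq _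
  rw [sc_two_mul, he]
  let _ : Algebra ℕ Rtau := Semiring.toNatAlgebra
  let _ : Algebra ℤ Rtau := Ring.toIntAlgebra _
  simp only [add_sub_cancel_left, mul_add, sub_mul, mul_one, mul_smul_comm, smul_mul_assoc,
    smul_add, smul_sub, smul_smul, pow_two, mul_assoc, smul_neg]
  module

theorem twist_C₂ (hx : IsRep μ ν x) (hy : IsRep μ ν y) (hxy : ∀ i j, Commute (x i) (y j)) :
    SemiconjBy (expT (x .D * y .H)) (untwistedGen ν x y .C₂)
    (coproductGen ν x y .C₂) := by
  have h1 := semiconj_expT_weight (r := -1) (hxy .D .H) (hxy .C₂ .H).symm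
    (by rw [hx.DC₂, neg_smul, one_smul])
  rw [neg_smul, one_smul] at h1
  set e := expT (-y .H) with he
  have hHe : Commute (y .H) e := commute_expT (Commute.refl _).neg_right
  have hDe : Commute (x .D) e := commute_expT (hxy _ _).neg_right
  have hKe : y .K * e = e * y .K - (tau * sc ν) • (e * (e * y .P)) := by
    have := hy.K_expT_neg_H
    rw [Ring.lie_def, sub_eq_iff_eq_add] at this
    rw [this]; abel
  have hHeep : Commute (y .H) (e * (e * y .P)) := hHe.mul_right (hHe.mul_right hy.commute_HP)
  have hDeep : Commute (x .D) (e * (e * y .P)) := hDe.mul_right (hDe.mul_right (hxy _ _))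
  have h5 : ⁅x .D * y .H, y .C₂⁆ =
      x .D * ((2 : Rtau) • (e * y .K) - (tau * sc ν) • (e * (e * y .P))) := by
    rw [mul_bracket, hy.HC₂, commute_iff_lie_eq.1 (hxy .D .C₂), zero_mul, add_zero, ← he, hKe,
      two_smul, add_sub_assoc]
  have h6 : ⁅x .D * y .H, x .D * ((2 : Rtau) • (e * y .K) - (tau * sc ν) • (e * (e * y .P)))⁆ =
      (2 : Rtau) • -(sc ν • (x .D ^ 2 * (e * (e * y .P)))) := by
    rw [mul_bracket, bracket_mul, bracket_mul, commute_iff_lie_eq.1 (Commute.refl (x .D)),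
      commute_iff_lie_eq.1 (hxy .D .H).symm, bracket_sub, bracket_sub, bracket_smul, bracket_smul, bracket_smul,
      bracket_smul, commute_iff_lie_eq.1 hHeep, commute_iff_lie_eq.1 hDeep, bracket_mul, bracket_mul,
      commute_iff_lie_eq.1 hHe, commute_iff_lie_eq.1 hDe, commute_iff_lie_eq.1 (hxy .D .K),
      bracket_swap hy.KH, ← he]
    simp only [zero_mul, mul_zero, zero_add, add_zero, smul_zero, sub_zero, mul_neg, smul_neg,
      mul_smul_comm, pow_two, mul_assoc]
  have h7 : Commute (x .D * y .H) (-(sc ν • (x .D ^ 2 * (e * (e * y .P))))) := by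
    refine Commute.neg_right (Commute.smul_right (Commute.mul_left ?_ ?_) _)
    · exact ((Commute.refl _).pow_right 2).mul_right hDeep
    · exact ((hxy .D .H).symm.pow_right 2).mul_right hHeep
  have h8 := SemiconjBy.add_right (expT_mul_of_lie h5 h6 h7) h1
  simp only [untwistedGen, coproductGen]
  convert h8 using 1
  rw [expT_neg_two_mul, ← he]
  let _ : Algebra ℕ Rtau := Semiring.toNatAlgebra
  let _ : Algebra ℤ Rtau := Ring.toIntAlgebra _
  simp only [add_mul, mul_sub, mul_smul_comm, smul_add, smul_sub, smul_smul, pow_two,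
    mul_assoc, smul_neg]
  module

end Twist

/-! ### The coproduct preserves the deformed commutation rules -/

section Coproduct

variable {B : Type} [Ring B] [Algebra Rtau B] {μ ν : ℝ}

theorem sc_two : sc 2 = 2 := map_ofNat _ 2

theorem twist_cancel {z a b b' : Hat B} (h : SemiconjBy (expT z) a b)
    (h' : SemiconjBy (expT z) a b') : b = b' := by
  have h1 : b * expT z = b' * expT z := h.eq.symm.trans h'.eq
  calc b = b * expT z * expT (-z) := by rw [mul_assoc, expT_mul_expT_neg, mul_one]
    _ = b' := by rw [h1, mul_assoc, expT_mul_expT_neg, mul_one]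

/-- A commutation rule is preserved under conjugation by a twist. -/
theorem bracket_of_twist {z a a' b b' c c' : Hat B} (ha : SemiconjBy (expT z) a a')
    (hb : SemiconjBy (expT z) b b') (hc : SemiconjBy (expT z) c c') (h : ⁅a, b⁆ = c) :
    ⁅a', b'⁆ = c' := by
  refine twist_cancel (z := z) (a := c) ?_ hc
  rw [← h, Ring.lie_def, Ring.lie_def]
  exact (ha.mul_right hb).sub_right (hb.mul_right ha)

theorem semiconjBy_smul {z a a' : Hat B} (r : Rtau) (h : SemiconjBy z a a') :
    SemiconjBy z (r • a) (r • a') := by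
  rw [SemiconjBy, mul_smul_comm, h.eq, smul_mul_assoc]

variable {x y : Gen → Hat B}

/-- The deformed commutation rules that do not involve `H` on the left-hand side hold before
twisting, because they are, up to the shift of `C₁`, the rules of a Lie algebra with primitive
generators. -/
theorem untwisted_rules (hx : IsRep μ ν x) (hy : IsRep μ ν y)
    (hxy : ∀ i j, Commute (x i) (y j)) (w : Gen → Hat B) (hw : w = untwistedGen ν x y) :
    ⁅w .K, w .P⁆ = sc μ • w .H ∧
    ⁅w .K, w .D⁆ = 0 ∧
    ⁅w .D, w .C₁⁆ = -w .C₁ + (tau * sc ν) • (w .D * w .D) ∧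
    ⁅w .D, w .P⁆ = w .P ∧
    ⁅w .D, w .C₂⁆ = -w .C₂ ∧
    ⁅w .P, w .C₂⁆ = sc (2 * μ) • w .D ∧
    ⁅w .K, w .C₁⁆ = sc ν • w .C₂ ∧
    ⁅w .K, w .C₂⁆ = sc μ • w .C₁ - (tau * sc (μ * ν)) • (w .D * w .D) ∧
    ⁅w .P, w .C₁⁆ = -((2 : Rtau) • w .K) - (tau * sc ν) • (w .D * w .P + w .P * w .D) ∧
    ⁅w .C₁, w .C₂⁆ = -((tau * sc ν) • (w .D * w .C₂ + w .C₂ * w .D)) := by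
  have h0 : ∀ i j, ⁅x i, y j⁆ = 0 := fun i j => commute_iff_lie_eq.1 (hxy i j)
  have h0' : ∀ i j, ⁅y j, x i⁆ = 0 := fun i j => commute_iff_lie_eq.1 (hxy i j).symm
  have hc : ∀ i j, y j * x i = x i * y j := fun i j => (hxy i j).symm.eq
  have hself : ∀ a : Hat B, ⁅a, a⁆ = 0 := fun a => commute_iff_lie_eq.1 (Commute.refl a)
  have hxPD := bracket_swap hx.DP
  have hyPD := bracket_swap hy.DP
  have two_mul' : ∀ a : Hat B, 2 * a = (2 : Rtau) • a := fun a => by rw [two_mul, two_smul]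
  let _ : Algebra ℕ Rtau := Semiring.toNatAlgebra
  let _ : Algebra ℤ Rtau := Ring.toIntAlgebra _
  subst hw
  refine ⟨?_, ?_, ?_, ?_, ?_, ?_, ?_, ?_, ?_, ?_⟩ <;>
    simp only [untwistedGen, bracket_add, add_bracket, bracket_smul, smul_bracket, mul_bracket,
      bracket_mul, h0, h0', hself, hx.KP, hy.KP, hx.KD, hy.KD, hx.DC₁, hy.DC₁, hx.DP, hy.DP,
      hx.DC₂, hy.DC₂, hx.PC₂, hy.PC₂, hx.KC₁, hy.KC₁, hx.KC₂, hy.KC₂, hx.PC₁, hy.PC₁, hx.C₁C₂,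
      hy.C₁C₂, hxPD, hyPD, mul_add, add_mul, mul_zero, zero_mul, add_zero, zero_add, smul_zero,
      mul_neg, neg_mul, pow_two, hc, sc_two, sc_mul, two_mul'] <;>
    module

theorem expT_neg_coproductGen_H (hxy : ∀ i j, Commute (x i) (y j)) :
    expT (-coproductGen ν x y .H) = expT (-x .H) * expT (-y .H) := by
  simp only [coproductGen]
  rw [neg_add, add_comm, expT_add ((hxy _ _).neg_left.neg_right)]

/-! The commutation rules with `H` on the left-hand side are not linear before twisting and are
checked directly. -/

theorem coproductGen_HP (hx : IsRep μ ν x) (hy : IsRep μ ν y)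
    (hxy : ∀ i j, Commute (x i) (y j)) :
    ⁅coproductGen ν x y .H, coproductGen ν x y .P⁆ = 0 := by
  refine commute_iff_lie_eq.1 (Commute.add_left ?_ ?_)
  · exact hy.commute_HP.add_right ((hxy _ _).symm.mul_right (commute_expT (Commute.refl _)))
  · exact (hxy _ _).add_right (hx.commute_HP.mul_right (commute_expT (hxy _ _)))

theorem coproductGen_HC₁ (hx : IsRep μ ν x) (hy : IsRep μ ν y)
    (hxy : ∀ i j, Commute (x i) (y j)) :
    ⁅coproductGen ν x y .H, coproductGen ν x y .C₁⁆ = -(sc (2 * ν) • coproductGen ν x y .D) := by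
  have h1 := commute_iff_lie_eq.1 (hxy .H .C₁)
  have h2 := commute_iff_lie_eq.1 (hxy .C₁ .H).symm
  have h3 := commute_iff_lie_eq.1 (commute_expT (hxy .H .H).neg_right)
  have h4 := commute_iff_lie_eq.1 (commute_expT (Commute.refl (y .H)).neg_right)
  simp only [coproductGen, bracket_add, add_bracket, bracket_mul, h1, h2, h3, h4, hx.HC₁, hy.HC₁,
    mul_zero, add_zero, zero_add, neg_mul, smul_mul_assoc, smul_add, neg_add]

theorem coproductGen_DH (hx : IsRep μ ν x) (hy : IsRep μ ν y)
    (hxy : ∀ i j, Commute (x i) (y j)) :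
    ⁅coproductGen ν x y .D, coproductGen ν x y .H⁆ = -expDivT (-coproductGen ν x y .H) := by
  have h1 := commute_iff_lie_eq.1 (hxy .D .H)
  have h2 := commute_iff_lie_eq.1 (hxy .H .D).symm
  have h3 := commute_iff_lie_eq.1 (commute_expT (hxy .H .H).neg_right).symm
  have h4 := commute_iff_lie_eq.1 (commute_expT (Commute.refl (y .H)).neg_right).symm
  have h5 : Commute (-y .H) (-x .H) := (hxy _ _).symm.neg_left.neg_right
  simp only [coproductGen, bracket_add, add_bracket, mul_bracket, h1, h2, h3, h4, hx.DH, hy.DH,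
    mul_zero, zero_mul, add_zero, zero_add, neg_mul]
  rw [neg_add, expDivT_add h5, neg_add, (commute_expT (commute_expDivT h5).symm).eq]

theorem coproductGen_KH (hx : IsRep μ ν x) (hy : IsRep μ ν y)
    (hxy : ∀ i j, Commute (x i) (y j)) :
    ⁅coproductGen ν x y .K, coproductGen ν x y .H⁆ =
      sc ν • (expT (-coproductGen ν x y .H) * coproductGen ν x y .P) := by
  rw [expT_neg_coproductGen_H hxy]
  have h1 := commute_iff_lie_eq.1 (hxy .D .H)
  have h2 := commute_iff_lie_eq.1 (hxy .K .H)
  have h3 := commute_iff_lie_eq.1 (hxy .H .K).symm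
  have h4 := commute_iff_lie_eq.1 (hxy .H .P).symm
  have h5 := commute_iff_lie_eq.1 hy.commute_HP.symm
  have h6 := commute_iff_lie_eq.1 (commute_expT (hxy .H .H).neg_right).symm
  have h7 := commute_iff_lie_eq.1 (commute_expT (Commute.refl (y .H)).neg_right).symm
  have h8 : expT (-y .H) * (x .P * expT (y .H)) = x .P := by
    rw [← mul_assoc, ← (commute_expT (hxy .P .H).neg_right).eq, mul_assoc, expT_neg_mul_expT,
      mul_one]
  have h9 : expT (-x .H) = 1 + tau • expDivT (-x .H) := expT_eq _
  simp only [coproductGen, bracket_add, sub_bracket, add_bracket, smul_bracket, mul_bracket, h1, h2,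
    h3, h4, h5, h6, h7, hx.DH, hy.KH, hx.KH, mul_zero, zero_mul, add_zero, zero_add, neg_mul,
    mul_add, mul_assoc, h8]
  rw [h9]
  let _ : Algebra ℕ Rtau := Semiring.toNatAlgebra
  let _ : Algebra ℤ Rtau := Ring.toIntAlgebra _
  simp only [add_mul, one_mul, smul_mul_assoc, smul_add, smul_smul]
  module

theorem coproductGen_HC₂ (hx : IsRep μ ν x) (hy : IsRep μ ν y)
    (hxy : ∀ i j, Commute (x i) (y j)) :
    ⁅coproductGen ν x y .H, coproductGen ν x y .C₂⁆ =
      expT (-coproductGen ν x y .H) * coproductGen ν x y .K +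
        coproductGen ν x y .K * expT (-coproductGen ν x y .H) := by
  rw [expT_neg_coproductGen_H hxy]
  have h0 : ∀ i j, ⁅x i, y j⁆ = 0 := fun i j => commute_iff_lie_eq.1 (hxy i j)
  have h0' : ∀ i j, ⁅y j, x i⁆ = 0 := fun i j => commute_iff_lie_eq.1 (hxy i j).symm
  have hHxe := commute_iff_lie_eq.1 (commute_expT (hxy .H .H).neg_right)
  have hHye := commute_iff_lie_eq.1 (commute_expT (Commute.refl (y .H)).neg_right)
  have hτ : tau • expDivT (-x .H) = expT (-x .H) - 1 := by
    rw [expT_eq (-x .H), add_sub_cancel_left]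
  have hHD : ⁅x .H, x .D⁆ = expDivT (-x .H) := by rw [bracket_swap hx.DH, neg_neg]
  have hyHK := bracket_swap hy.KH
  let _ : Algebra ℕ Rtau := Semiring.toNatAlgebra
  let _ : Algebra ℤ Rtau := Ring.toIntAlgebra _
  have key : ⁅coproductGen ν x y .H, coproductGen ν x y .C₂⁆ =
      ⁅y .H, y .C₂⁆ + ⁅x .H, x .C₂⁆ * expT (-y .H)
      + (2 : Rtau) • ((tau • expDivT (-x .H)) * (expT (-y .H) * y .K))
      - (2 * tau * sc ν) • (x .D * (expT (-y .H) * (expT (-y .H) * y .P)))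
      - (tau * sc ν) • (((tau • expDivT (-x .H)) * x .D + x .D * (tau • expDivT (-x .H))
          + tau • expDivT (-x .H)) * (expT (-y .H) * (expT (-y .H) * y .P))) := by
    simp only [coproductGen, expT_neg_two_mul, bracket_add, bracket_sub, add_bracket, bracket_smul,
      bracket_mul, h0, h0', hHxe, hHye, hHD, hyHK, hy.HP, pow_two, mul_zero, zero_mul, add_zero,
      zero_add, mul_neg, smul_mul_assoc, mul_smul_comm, add_mul, mul_assoc, smul_add,
      smul_neg]
    module
  rw [key, hx.HC₂, hy.HC₂, hτ]
  simp only [coproductGen]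
  have hxe : ∀ i, Commute (x i) (expT (-y .H)) := fun i => commute_expT (hxy _ _).neg_right
  have hye : ∀ i, Commute (y i) (expT (-x .H)) := fun i => commute_expT (hxy _ _).symm.neg_right
  have hee : Commute (expT (-y .H)) (expT (-x .H)) :=
    commute_expT ((commute_expT (hxy _ _).neg_right).symm.neg_right)
  have hPe : Commute (y .P) (expT (-y .H)) := commute_expT hy.commute_HP.symm.neg_right
  have hKx := hx.K_expT_neg_H
  have hKy := hy.K_expT_neg_H
  have hDx := hx.D_expT_neg_H
  rw [Ring.lie_def, sub_eq_iff_eq_add] at hKx hKy hDx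
  generalize expT (-x .H) = ex at *
  generalize expT (-y .H) = ey at *
  have c1 : ∀ i, ey * x i = x i * ey := fun i => (hxe i).symm.eq
  have c1' : ∀ i z, ey * (x i * z) = x i * (ey * z) := fun i z => by
    rw [← mul_assoc, c1, mul_assoc]
  have c2' : ∀ i z, y i * (ex * z) = ex * (y i * z) := fun i z => by
    rw [← mul_assoc, (hye i).eq, mul_assoc]
  have c3' : ∀ z, ey * (ex * z) = ex * (ey * z) := fun z => by rw [← mul_assoc, hee.eq, mul_assoc]
  have c4 : y .P * ey = ey * y .P := hPe.eq
  have c5 : ∀ z, x .D * (ex * z) = (ex * (ex * z)) - ex * z + ex * (x .D * z) := fun z => by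
    rw [← mul_assoc, hDx, add_mul, sub_mul]; simp only [mul_assoc]
  have c6 : ∀ z, x .K * (ex * z) =
      -((tau * sc ν) • (ex * (ex * (x .P * z)))) + ex * (x .K * z) := fun z => by
    rw [← mul_assoc, hKx, add_mul, neg_mul, smul_mul_assoc]; simp only [mul_assoc]
  simp only [mul_add, add_mul, mul_sub, sub_mul, mul_assoc, one_mul, mul_one, smul_mul_assoc,
    mul_smul_comm, smul_add, smul_sub, mul_neg, neg_mul, c1, c1', c2', c3', c4, c5, c6, hKx, hKy, hDx]
  module

theorem isRep_coproductGen (hx : IsRep μ ν x) (hy : IsRep μ ν y)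
    (hxy : ∀ i j, Commute (x i) (y j)) : IsRep μ ν (coproductGen ν x y) := by
  obtain ⟨hKP, hKD, hDC₁, hDP, hDC₂, hPC₂, hKC₁, hKC₂, hPC₁, hC₁C₂⟩ :=
    untwisted_rules hx hy hxy _ rfl
  have tH := twist_H hx hxy
  have tP := twist_P hx hy hxy
  have tD := twist_D hy hxy
  have tK := twist_K hx hy hxy
  have tC₁ := twist_C₁ hx hy hxy
  have tC₂ := twist_C₂ hx hy hxy
  have two_mul' : ∀ a : Hat B, 2 * a = (2 : Rtau) • a := fun a => by rw [two_mul, two_smul]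
  constructor
  case KH => exact coproductGen_KH hx hy hxy
  case KP => exact bracket_of_twist tK tP (semiconjBy_smul _ tH) hKP
  case HP => exact coproductGen_HP hx hy hxy
  case KD => exact bracket_of_twist tK tD (SemiconjBy.zero_right _) hKD
  case DH => exact coproductGen_DH hx hy hxy
  case DC₁ =>
    rw [pow_two]
    exact bracket_of_twist tD tC₁ (tC₁.neg_right.add_right (semiconjBy_smul _ (tD.mul_right tD)))
      hDC₁
  case HC₁ => exact coproductGen_HC₁ hx hy hxy
  case DP => exact bracket_of_twist tD tP tP hDP
  case DC₂ => exact bracket_of_twist tD tC₂ tC₂.neg_right hDC₂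
  case PC₂ => exact bracket_of_twist tP tC₂ (semiconjBy_smul _ tD) hPC₂
  case KC₁ => exact bracket_of_twist tK tC₁ (semiconjBy_smul _ tC₂) hKC₁
  case KC₂ =>
    rw [pow_two]
    exact bracket_of_twist tK tC₂
      ((semiconjBy_smul _ tC₁).sub_right (semiconjBy_smul _ (tD.mul_right tD))) hKC₂
  case HC₂ => exact coproductGen_HC₂ hx hy hxy
  case PC₁ =>
    rw [two_mul']
    exact bracket_of_twist tP tC₁ ((semiconjBy_smul _ tK).neg_right.sub_right
      (semiconjBy_smul _ ((tD.mul_right tP).add_right (tP.mul_right tD)))) hPC₁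
  case C₁C₂ =>
    exact bracket_of_twist tC₁ tC₂
      (semiconjBy_smul _ ((tD.mul_right tC₂).add_right (tC₂.mul_right tD))).neg_right hC₁C₂

end Coproduct

/-! ### Coassociativity, counit and the hexagon identity -/

section Bialgebra

variable {B : Type} [Ring B] [Algebra Rtau B] {B' : Type} [Ring B'] [Algebra Rtau B'] {μ ν : ℝ}

theorem map_coproductGen (f : Hat B →ₐ[Rtau] Hat B') (x y : Gen → Hat B) (g : Gen) :
    f (coproductGen ν x y g) = coproductGen ν (fun i => f (x i)) (fun i => f (y i)) g := by
  cases g <;>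
    simp only [coproductGen, map_add, map_sub, map_mul, map_smul, map_pow, map_expT, map_neg,
      map_ofNat]

theorem coproductGen_zero_left (y : Gen → Hat B) (g : Gen) :
    coproductGen ν (fun _ => 0) y g = y g := by
  cases g <;> simp [coproductGen]

theorem coproductGen_zero_right (x : Gen → Hat B) (g : Gen) :
    coproductGen ν x (fun _ => 0) g = x g := by
  cases g <;> simp [coproductGen]

variable {x y z : Gen → Hat B}

/-- Coassociativity on the generators; only `y`, in the middle slot, has to satisfy a commutation
rule, namely the one of `D` and `H`. -/
theorem coproductGen_assoc (hy : IsRep μ ν y) (hxy : ∀ i j, Commute (x i) (y j))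
    (hyz : ∀ i j, Commute (y i) (z j)) (g : Gen) :
    coproductGen ν x (coproductGen ν y z) g = coproductGen ν (coproductGen ν x y) z g := by
  have hP : expT (coproductGen ν y z .H) = expT (y .H) * expT (z .H) := by
    simp only [coproductGen]
    rw [add_comm, expT_add (hyz _ _)]
  have hneg := expT_neg_coproductGen_H (ν := ν) hyz
  have hD := hy.D_expT_neg_H
  rw [Ring.lie_def, sub_eq_iff_eq_add] at hD
  have hxe : ∀ i, Commute (expT (-y .H)) (x i) := fun i =>
    (commute_expT (hxy _ _).neg_right).symm
  have hee : Commute (expT (-z .H)) (expT (-y .H)) :=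
    commute_expT ((commute_expT (hyz _ _).neg_right).symm.neg_right)
  have hye : ∀ i, Commute (expT (-z .H)) (y i) := fun i =>
    (commute_expT (hyz _ _).neg_right).symm
  have hcancel : expT (-z .H) * expT (z .H) = 1 := expT_neg_mul_expT _
  let _ : Algebra ℕ Rtau := Semiring.toNatAlgebra
  let _ : Algebra ℤ Rtau := Ring.toIntAlgebra _
  cases g
  case H => simp only [coproductGen, add_assoc]
  case P =>
    rw [coproductGen, hP]
    simp only [coproductGen, add_mul, mul_assoc, add_assoc]
  case C₁ =>
    rw [coproductGen, hneg]
    simp only [coproductGen, add_mul, mul_assoc, add_assoc]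
  case D =>
    rw [coproductGen, hneg]
    simp only [coproductGen, add_mul, mul_assoc, add_assoc]
  case K =>
    rw [coproductGen, hneg]
    simp only [coproductGen]
    generalize expT (-y .H) = ey at *
    generalize expT (-z .H) = ez at *
    have c1 : ∀ w, ez * (y .P * w) = y .P * (ez * w) := fun w => by
      rw [← mul_assoc, (hye .P).eq, mul_assoc]
    simp only [mul_add, add_mul, mul_assoc, smul_add, c1, hcancel, mul_one]
    module
  case C₂ =>
    rw [coproductGen, expT_neg_two_mul, hneg]
    simp only [coproductGen, expT_neg_two_mul]
    generalize expT (-y .H) = ey at *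
    generalize expT (-z .H) = ez at *
    have c1 : ∀ i w, ez * (y i * w) = y i * (ez * w) := fun i w => by
      rw [← mul_assoc, (hye i).eq, mul_assoc]
    have c2 : ∀ i w, ey * (x i * w) = x i * (ey * w) := fun i w => by
      rw [← mul_assoc, (hxe i).eq, mul_assoc]
    have c3 : ∀ w, ez * (ey * w) = ey * (ez * w) := fun w => by
      rw [← mul_assoc, hee.eq, mul_assoc]
    have c4 : ∀ w, y .D * (ey * w) = ey * (ey * w) - ey * w + ey * (y .D * w) := fun w => by
      rw [← mul_assoc, hD, add_mul, sub_mul]; simp only [mul_assoc]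
    have c5 : ∀ i w, y i * (x .D * w) = x .D * (y i * w) := fun i w => by
      rw [← mul_assoc, (hxy .D i).symm.eq, mul_assoc]
    have c6 : ∀ i, ez * y i = y i * ez := fun i => (hye i).eq
    simp only [pow_two, mul_add, add_mul, mul_sub, sub_mul, mul_assoc, smul_add, smul_sub,
      mul_smul_comm, smul_mul_assoc, smul_smul, c1, c2, c3, c4, c5, c6, hcancel, mul_one]
    module

/-- The first hexagon identity for `exp (τ H ⊗ D) exp (-τ D ⊗ H)`. Both sides are moved into the
form `exp (τ H₂ D₃) exp (-τ D₁ v) exp (-τ D₂ H₃)`, where `v` is the conjugate of `H₃` by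
`exp (-τ H₂ D₃)`. The conjugate `u` of `H₂` by `exp (-τ D₂ H₃)` satisfies `H₂ + v = H₃ + u`, as
both sides have the same image under `(exp (τ ·) - 1) / τ`. -/
theorem hexagon (hy : IsRep μ ν y) (hz : IsRep μ ν z) (hxy : ∀ i j, Commute (x i) (y j))
    (hxz : ∀ i j, Commute (x i) (z j)) (hyz : ∀ i j, Commute (y i) (z j)) :
    expT (coproductGen ν x y .H * z .D) * expT (-(coproductGen ν x y .D * z .H)) =
      (expT (x .H * z .D) * expT (-(x .D * z .H))) *
        (expT (y .H * z .D) * expT (-(y .D * z .H))) := by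
  set b := expT (-(y .D * z .H)) with hb
  set b' := expT (y .D * z .H) with hb'
  set c := expT (y .H * z .D) with hc
  set c' := expT (-(y .H * z .D)) with hc'
  have hbb' : b' * b = 1 := expT_mul_expT_neg _
  have hcc' : c * c' = 1 := expT_mul_expT_neg _
  set u := b * y .H * b' with hu
  set v := c' * z .H * c with hv
  have hub : SemiconjBy b (y .H) u := by
    rw [SemiconjBy, hu, mul_assoc, hbb', mul_one]
  have hvc : SemiconjBy c' (z .H) v := by
    rw [SemiconjBy, hv, mul_assoc, hcc', mul_one]
  have hEu : expDivT u = expDivT (y .H) * expT (-z .H) := by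
    have h1 := semiconj_expT_weight (r := 1) (hyz .D .H).neg_right
      (commute_expDivT (hyz .H .H).symm).neg_left (by rw [hy.D_expDivT_H, one_smul])
    rw [mul_neg, one_smul] at h1
    exact twist_cancel (semiconjBy_expDivT hub) h1
  have hEv : expDivT v = expDivT (z .H) * expT (-y .H) := by
    have h1 := semiconj_expT_weight (r := 1) (hyz .H .D).symm.neg_right
      (commute_expDivT (hyz .H .H)).neg_left (by rw [hz.D_expDivT_H, one_smul])
    rw [mul_neg, one_smul, ← (hyz .H .D).eq] at h1
    exact twist_cancel (semiconjBy_expDivT hvc) h1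
  have hyv : Commute (y .H) v := by
    have h1 : Commute (y .H) (y .H * z .D) := (Commute.refl _).mul_right (hyz _ _)
    exact ((commute_expT h1.neg_right).mul_right (hyz _ _)).mul_right (commute_expT h1)
  have hzu : Commute (z .H) u := by
    have h1 : Commute (z .H) (y .D * z .H) := (hyz _ _).symm.mul_right (Commute.refl _)
    exact ((commute_expT h1.neg_right).mul_right (hyz _ _).symm).mul_right (commute_expT h1)
  have hxu : Commute (x .D) u := by
    have h1 : Commute (x .D) (y .D * z .H) := (hxy _ _).mul_right (hxz _ _)
    exact ((commute_expT h1.neg_right).mul_right (hxy _ _)).mul_right (commute_expT h1)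
  have huv : y .H + v = z .H + u := by
    apply expDivT_injective
    have h1 : Commute (expT (y .H)) (expDivT (z .H)) :=
      (commute_expT (commute_expDivT (hyz _ _)).symm).symm
    have h2 : Commute (expT (z .H)) (expDivT (y .H)) :=
      (commute_expT (commute_expDivT (hyz _ _).symm).symm).symm
    rw [expDivT_add hyv, expDivT_add hzu, hEu, hEv, ← mul_assoc, ← mul_assoc, h1.eq, h2.eq,
      mul_assoc, mul_assoc, expT_mul_expT_neg, expT_mul_expT_neg, mul_one, mul_one, add_comm]
  have hyu : Commute (y .H) u := by
    rw [← sub_eq_iff_eq_add'.2 huv]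
    exact ((Commute.refl _).add_right hyv).sub_right (hyz _ _)
  -- The factor `exp (-τ (D₂ + D₁ exp (-τ H₂)) H₃)`, by conjugation with `exp (τ D₁ H₂)`.
  have hT : expT (-(coproductGen ν x y .D * z .H)) = expT (-(x .D * v)) * b := by
    have h1 : Commute (expT (x .D * y .H)) (z .H) :=
      (commute_expT ((hxz _ _).mul_left (hyz _ _)).symm).symm
    have h2 := semiconjBy_expT (((twist_D (ν := ν) hy hxy).mul_right h1).neg_right)
    have h3 : expT (-(untwistedGen ν x y .D * z .H)) = expT (-(x .D * z .H)) * b := by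
      have h4 : Commute (-(x .D * z .H)) (-(y .D * z .H)) :=
        (((hxy _ _).mul_right (hxz _ _)).mul_left
          ((hyz _ _).symm.mul_right (Commute.refl _))).neg_left.neg_right
      rw [hb, ← expT_add h4]
      simp only [untwistedGen, add_mul, neg_add_rev]
    rw [h3] at h2
    have h5 : SemiconjBy b (expT (-(x .D * y .H))) (expT (-(x .D * u))) := by
      have h6 : Commute b (x .D) :=
        (commute_expT (((hxy _ _).mul_right (hxz _ _)).neg_right)).symm
      exact semiconjBy_expT (SemiconjBy.mul_right h6 hub).neg_right
    have h7 : expT (-(x .D * v)) =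
        expT (x .D * y .H) * expT (-(x .D * z .H)) * expT (-(x .D * u)) := by
      have hxx : ∀ {p q : Hat B}, Commute (x .D) p → Commute (x .D) q → Commute p q →
          Commute (x .D * p) (x .D * q) := fun hp hq hpq =>
        ((Commute.refl _).mul_right hq).mul_left (hp.symm.mul_right hpq)
      have h8 := hxx (hxy _ .H) (hxz _ .H) (hyz .H .H)
      have h9 := hxx (hxy _ .H) hxu hyu
      have h10 := hxx (hxz _ .H) hxu hzu
      rw [← expT_add h8.neg_right, ← expT_add (h9.add_left h10.neg_left).neg_right,
        eq_sub_of_add_eq' huv]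
      congr 1
      simp only [mul_sub, mul_add]
      abel
    calc expT (-(coproductGen ν x y .D * z .H))
        = expT (-(coproductGen ν x y .D * z .H)) * expT (x .D * y .H) *
            expT (-(x .D * y .H)) := by rw [mul_assoc, expT_mul_expT_neg, mul_one]
      _ = expT (x .D * y .H) * (expT (-(x .D * z .H)) * (b * expT (-(x .D * y .H)))) := by
          rw [← h2.eq]; simp only [mul_assoc]
      _ = expT (-(x .D * v)) * b := by rw [h5.eq, h7]; simp only [mul_assoc]
  have hV : expT (-(x .D * z .H)) * c = c * expT (-(x .D * v)) := by
    have h1 : Commute c' (x .D) :=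
      (commute_expT (((hxy _ _).mul_right (hxz _ _)).neg_right)).symm
    have h2 := semiconjBy_expT (SemiconjBy.mul_right h1 hvc).neg_right
    have h3 : c' * c = 1 := expT_neg_mul_expT _
    calc expT (-(x .D * z .H)) * c = c * (c' * expT (-(x .D * z .H))) * c := by
          rw [← mul_assoc c, hcc', one_mul]
      _ = c * expT (-(x .D * v)) := by rw [h2.eq, mul_assoc, mul_assoc, h3, mul_one]
  have hH : expT (coproductGen ν x y .H * z .D) = expT (x .H * z .D) * c := by
    have h1 : Commute (x .H * z .D) (y .H * z .D) :=
      ((hxy _ _).mul_right (hxz _ _)).mul_left ((hyz _ _).symm.mul_right (Commute.refl _))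
    rw [hc, ← expT_add h1]
    simp only [coproductGen, add_mul, add_comm]
  rw [hH, hT, mul_assoc, mul_assoc, ← mul_assoc c, ← hV]
  simp only [mul_assoc]

end Bialgebra

/-! ### The universal `R`-matrix -/

section Final

variable {μ ν : ℝ}

theorem isCoproduct_iff {Δ : U μ ν →ₐ[Rtau] Hat2 (U μ ν)} :
    IsCoproduct μ ν Δ ↔ ∀ g, Δ (gen μ ν g) =
      coproductGen ν (fun i => in1 (gen μ ν i)) (fun i => in2 (gen μ ν i)) g := by
  constructor
  · intro h g
    cases g <;>
      simp only [h.map_H, h.map_D, h.map_P, h.map_C₁, h.map_K, h.map_C₂, tens_eq, coproductGen,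
        map_one, one_mul, mul_one, map_mul, map_add, map_pow, map_expT, map_neg, map_ofNat]
  · intro h
    constructor <;>
      simp only [h, tens_eq, coproductGen, map_one, one_mul, mul_one, map_mul, map_add, map_pow,
        map_expT, map_neg, map_ofNat]

theorem existsUnique_coproduct (μ ν : ℝ) :
    ∃! Δ : U μ ν →ₐ[Rtau] Hat2 (U μ ν), IsCoproduct μ ν Δ := by
  refine ⟨lift (isRep_coproductGen ((isRep_gen μ ν).map in1) ((isRep_gen μ ν).map in2)
    fun i j => commute_in _ _), isCoproduct_iff.2 fun g => lift_gen _ g, fun Δ hΔ => ?_⟩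
  exact U_hom_ext fun g => by rw [isCoproduct_iff.1 hΔ g, lift_gen]

theorem isBialgebra_counit {Δ : U μ ν →ₐ[Rtau] Hat2 (U μ ν)} (hΔ : IsCoproduct μ ν Δ) :
    IsBialgebra Δ (counit μ ν) := by
  rw [isCoproduct_iff] at hΔ
  refine ⟨AlgHom.congr_fun (φ₁ := (idDelta Δ).comp Δ) (φ₂ := (deltaId Δ).comp Δ) ?_,
    AlgHom.congr_fun (φ₁ := (epsId (counit μ ν)).comp Δ) (φ₂ := toHat) ?_,
    AlgHom.congr_fun (φ₁ := (idEps (counit μ ν)).comp Δ) (φ₂ := toHat) ?_⟩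
  · refine U_hom_ext fun g => ?_
    simp only [AlgHom.comp_apply, hΔ, map_coproductGen, idDelta_in1, idDelta_in2, deltaId_in1,
      deltaId_in2, leg12_in1, leg12_in2, leg23_in1, leg23_in2]
    exact coproductGen_assoc ((isRep_gen μ ν).map slot2) (fun i j => commute12 _ _)
      (fun i j => commute23 _ _) g
  · refine U_hom_ext fun g => ?_
    simp only [AlgHom.comp_apply, hΔ, map_coproductGen, epsId_in1, epsId_in2, counit_gen, map_zero,
      coproductGen_zero_left]
  · refine U_hom_ext fun g => ?_
    simp only [AlgHom.comp_apply, hΔ, map_coproductGen, idEps_in1, idEps_in2, counit_gen, map_zero,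
      coproductGen_zero_right]

theorem flipHat_coproduct {Δ : U μ ν →ₐ[Rtau] Hat2 (U μ ν)} (hΔ : IsCoproduct μ ν Δ) (g : Gen) :
    flipHat (Δ (gen μ ν g)) =
      coproductGen ν (fun i => in2 (gen μ ν i)) (fun i => in1 (gen μ ν i)) g := by
  simp only [isCoproduct_iff.1 hΔ, map_coproductGen, flipHat_in1, flipHat_in2]

theorem DH_eq : DH μ ν = in1 (gen μ ν .D) * in2 (gen μ ν .H) := tens_eq _ _

theorem HD_eq : HD μ ν = in2 (gen μ ν .D) * in1 (gen μ ν .H) :=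
  (tens_eq _ _).trans (commute_in _ _).eq

theorem flipHat_DH : flipHat (DH μ ν) = HD μ ν := by
  simp only [DH_eq, HD_eq, map_mul, flipHat_in1, flipHat_in2]

theorem flipHat_HD : flipHat (HD μ ν) = DH μ ν := by
  rw [← flipHat_DH, flipHat_flipHat]

/-- The `R`-matrix as a unit. -/
def RUnit (μ ν : ℝ) : (Hat2 (U μ ν))ˣ where
  val := Rmat μ ν
  inv := expT (DH μ ν) * expT (-HD μ ν)
  val_inv := by
    rw [Rmat, mul_assoc, ← mul_assoc (expT (-DH μ ν)), expT_neg_mul_expT, one_mul,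
      expT_mul_expT_neg]
  inv_val := by
    rw [Rmat, mul_assoc, ← mul_assoc (expT (-HD μ ν)), expT_neg_mul_expT, one_mul,
      expT_mul_expT_neg]

theorem untwistedGen_swap (g : Gen) :
    untwistedGen ν (fun i => in1 (gen μ ν i)) (fun i => in2 (gen μ ν i)) g =
      untwistedGen ν (fun i => in2 (gen μ ν i)) (fun i => in1 (gen μ ν i)) g := by
  cases g <;> simp only [untwistedGen, (commute_in (gen μ ν .D) (gen μ ν .D)).eq] <;> abel

theorem twist_generators {B : Type} [Ring B] [Algebra Rtau B] {x y : Gen → Hat B}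
    (hx : IsRep μ ν x) (hy : IsRep μ ν y) (hxy : ∀ i j, Commute (x i) (y j)) {g : Gen}
    (hg : g ≠ .H) :
    SemiconjBy (expT (x .D * y .H)) (untwistedGen ν x y g) (coproductGen ν x y g) := by
  cases g
  · exact absurd rfl hg
  · exact twist_P hx hy hxy
  · exact twist_K hx hy hxy
  · exact twist_D hy hxy
  · exact twist_C₁ hx hy hxy
  · exact twist_C₂ hx hy hxy

/-- `exp (-τ D ⊗ H)` carries the coproduct of a generator to its untwisted value. -/
theorem untwist {Δ : U μ ν →ₐ[Rtau] Hat2 (U μ ν)} (hΔ : IsCoproduct μ ν Δ) {g : Gen}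
    (hg : g ≠ .H) : expT (-DH μ ν) * Δ (gen μ ν g) * expT (DH μ ν) =
      untwistedGen ν (fun i => in1 (gen μ ν i)) (fun i => in2 (gen μ ν i)) g := by
  have h := twist_generators ((isRep_gen μ ν).map in1) ((isRep_gen μ ν).map in2)
    (fun i j => commute_in _ _) hg
  rw [isCoproduct_iff.1 hΔ, DH_eq, mul_assoc, ← h.eq, ← mul_assoc, expT_neg_mul_expT, one_mul]

/-- `exp (τ H ⊗ D)` carries the untwisted value of a generator to its opposite coproduct. -/
theorem twist_op {Δ : U μ ν →ₐ[Rtau] Hat2 (U μ ν)} (hΔ : IsCoproduct μ ν Δ) {g : Gen}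
    (hg : g ≠ .H) : expT (HD μ ν) *
      untwistedGen ν (fun i => in1 (gen μ ν i)) (fun i => in2 (gen μ ν i)) g * expT (-HD μ ν) =
      flipHat (Δ (gen μ ν g)) := by
  have h := congrArg flipHat (untwist hΔ hg)
  have h1 : flipHat (untwistedGen ν (fun i => in1 (gen μ ν i)) (fun i => in2 (gen μ ν i)) g) =
      untwistedGen ν (fun i => in1 (gen μ ν i)) (fun i => in2 (gen μ ν i)) g := by
    conv_rhs => rw [untwistedGen_swap]
    cases g <;>
      simp only [untwistedGen, map_add, map_smul, map_mul, map_expDivT, flipHat_in1, flipHat_in2]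
  rw [map_mul, map_mul, map_expT, map_expT, map_neg, flipHat_DH, h1] at h
  rw [← h, ← mul_assoc, ← mul_assoc, expT_mul_expT_neg, one_mul, mul_assoc, expT_mul_expT_neg,
    mul_one]

theorem RUnit_conj_gen {Δ : U μ ν →ₐ[Rtau] Hat2 (U μ ν)} (hΔ : IsCoproduct μ ν Δ) (g : Gen) :
    (RUnit μ ν).val * Δ (gen μ ν g) * (RUnit μ ν)⁻¹.val = flipHat (Δ (gen μ ν g)) := by
  by_cases hg : g = .H
  · subst hg
    -- `(exp (τ H) - 1) / τ` is untwisted and twisted back; it determines `H`.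
    have h1 := twist_H (ν := ν) ((isRep_gen μ ν).map in1)
      (y := fun i => in2 (gen μ ν i)) (fun i j => commute_in _ _)
    have h2 := twist_H (ν := ν) ((isRep_gen μ ν).map in2)
      (y := fun i => in1 (gen μ ν i)) (fun i j => (commute_in _ _).symm)
    rw [← untwistedGen_swap, ← flipHat_coproduct hΔ] at h2
    rw [← isCoproduct_iff.1 hΔ] at h1
    simp only [← DH_eq, ← HD_eq] at h1 h2
    apply expDivT_injective
    have h3 := map_expDivT (conjHom (RUnit μ ν)) (Δ (gen μ ν .H))
    rw [conjHom_apply, conjHom_apply] at h3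
    rw [← h3]
    change expT (HD μ ν) * expT (-DH μ ν) * _ * (expT (DH μ ν) * expT (-HD μ ν)) = _
    rw [← mul_assoc, mul_assoc (_ * _) (expDivT _), ← h1.eq, mul_assoc (expT (HD μ ν)),
      ← mul_assoc (expT (-DH μ ν)), expT_neg_mul_expT, one_mul, h2.eq, mul_assoc,
      expT_mul_expT_neg, mul_one]
  · rw [← twist_op hΔ hg, ← untwist hΔ hg]
    change expT (HD μ ν) * expT (-DH μ ν) * _ * (expT (DH μ ν) * expT (-HD μ ν)) = _
    simp only [mul_assoc]

theorem isTriangular_RUnit {Δ : U μ ν →ₐ[Rtau] Hat2 (U μ ν)} (hΔ : IsCoproduct μ ν Δ) :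
    IsTriangularRMatrix Δ (RUnit μ ν) := by
  have htri : flipHat (RUnit μ ν).val = (RUnit μ ν)⁻¹.val := by
    change flipHat (expT (HD μ ν) * expT (-DH μ ν)) = expT (DH μ ν) * expT (-HD μ ν)
    rw [map_mul, map_expT, map_expT, map_neg, flipHat_DH, flipHat_HD]
  have hdelta : deltaId Δ (RUnit μ ν).val = leg13 (RUnit μ ν).val * leg23 (RUnit μ ν).val := by
    have h := hexagon (ν := ν) (x := fun i => slot1 (gen μ ν i)) ((isRep_gen μ ν).map slot2)
      ((isRep_gen μ ν).map slot3) (fun i j => commute12 _ _) (fun i j => commute13 _ _)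
      (fun i j => commute23 _ _)
    change deltaId Δ (expT (HD μ ν) * expT (-DH μ ν)) =
      leg13 (expT (HD μ ν) * expT (-DH μ ν)) * leg23 (expT (HD μ ν) * expT (-DH μ ν))
    have hHD : HD μ ν = in1 (gen μ ν .H) * in2 (gen μ ν .D) := tens_eq _ _
    simp only [map_mul, map_expT, map_neg, hHD, DH_eq, deltaId_in1, deltaId_in2,
      isCoproduct_iff.1 hΔ, map_coproductGen, leg12_in1, leg12_in2, leg13_in1, leg13_in2,
      leg23_in1, leg23_in2]
    exact h
  refine ⟨AlgHom.congr_fun (φ₁ := (conjHom (RUnit μ ν)).comp Δ) (φ₂ := flipHat.comp Δ)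
    (U_hom_ext fun g => RUnit_conj_gen hΔ g), hdelta, id_delta_of_delta_id htri hdelta, htri⟩

end Final

end JordanianSO22

end

theorem mainTheorem2 (μ ν : ℝ) :
    (∃! Δ : U μ ν →ₐ[Rtau] Hat2 (U μ ν),
      IsCoproduct μ ν Δ) ∧
    ∀ Δ : U μ ν →ₐ[Rtau] Hat2 (U μ ν),
      IsCoproduct μ ν Δ →
      (∃ ε : U μ ν →ₐ[Rtau] Rtau,
        (∀ X, ε (gen μ ν X) = 0) ∧ IsBialgebra Δ ε) ∧
      (∃ R : (Hat2 (U μ ν))ˣ,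
        R.val = Rmat μ ν ∧
        IsTriangularRMatrix Δ R ∧
        YangBaxter R.val ∧
        ∀ X, R.val * Δ (gen μ ν X) * R⁻¹.val =
          flipHat (Δ (gen μ ν X))) ∧
      (expT (-DH μ ν) * Δ (gen μ ν .C₁) *
          expT (DH μ ν) = fElt μ ν ∧
        expT (HD μ ν) * fElt μ ν *
          expT (-HD μ ν) =
            flipHat (Δ (gen μ ν .C₁))) ∧
      (∀ X : Gen, X = .P ∨ X = .K ∨ X = .C₂ →
        expT (-DH μ ν) * Δ (gen μ ν X) *
            expT (DH μ ν) = prim μ ν X ∧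
          expT (HD μ ν) * prim μ ν X *
            expT (-HD μ ν) =
              flipHat (Δ (gen μ ν X))) := by
  refine ⟨existsUnique_coproduct μ ν, fun Δ hΔ => ⟨⟨counit μ ν, counit_gen, isBialgebra_counit hΔ⟩,
    ⟨RUnit μ ν, rfl, isTriangular_RUnit hΔ, ?_, RUnit_conj_gen hΔ⟩, ?_, ?_⟩⟩
  · exact yangBaxter_of_conj (isTriangular_RUnit hΔ).conj_coproduct (isTriangular_RUnit hΔ).delta_id
  · have hf : fElt μ ν =
        untwistedGen ν (fun i => in1 (gen μ ν i)) (fun i => in2 (gen μ ν i)) .C₁ := by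
      simp only [fElt, prim, untwistedGen, tens_eq, map_one, one_mul, mul_one]
    rw [hf]
    exact ⟨untwist hΔ (by simp), twist_op hΔ (by simp)⟩
  · intro X hX
    have hp : prim μ ν X =
        untwistedGen ν (fun i => in1 (gen μ ν i)) (fun i => in2 (gen μ ν i)) X := by
      rcases hX with rfl | rfl | rfl <;>
        simp only [prim, untwistedGen, tens_eq, map_one, one_mul, mul_one]
    have hH : X ≠ .H := by rcases hX with rfl | rfl | rfl <;> simp
    rw [hp]
    exact ⟨untwist hΔ hH, twist_op hΔ hH⟩
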